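/- **Corollary 3.3.** Let $\widehat{\phantom{f}}$ denote the Fourier transform on $\mathbb{R}^2$ in the angular-frequency normalization (plane waves $e^{i(x\xi+y\eta)}$). For $s\ge 0$ and $\phi\in L^2(\mathbb{R}^2)$ let $D_x^s\phi$ and $D_y^s\phi$ be defined by $(D_x^s\phi)^\wedge(\xi,\eta)=|\xi|^s\widehat\phi(\xi,\eta)$ and $(D_y^s\phi)^\wedge(\xi,\eta)=|\eta|^s\widehat\phi(\xi,\eta)$, and for $t\in\mathbb{R}$ let $U_\alpha(t)\phi$ be defined by $$(U_\alpha(t)\phi)^\wedge(\xi,\eta)=e^{-it(|\xi|^\alpha\xi+\operatorname{sgn}(\xi)\eta^2)}\,\widehat\phi(\xi,\eta).$$ Let $\alpha\in(0,1]$. Then there is $\delta_0>0$ such that for every $\delta\in(0,\delta_0)$ there exist $\tilde k_\delta\in(0,\tfrac12)$ and $c_\delta>0$ (depending only on $\alpha$ and $\delta$) such that, for every $T>0$ and every complex-valued $\phi\in L^2(\mathbb{R}^2)$ with $D_x^{\frac14(1-\alpha)+\delta}\phi,\ D_y^\delta\phi,\ D_x^{\frac14(1-\alpha)}D_y^\delta\phi\in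 L^2(\mathbb{R}^2)$, $$\left(\int_0^T\|U_\alpha(t)\phi\|_{L^\infty(\mathbb{R}^2)}^2\,dt\right)^{1/2}\le c_\delta\,T^{\tilde k_\delta}\left(\|\phi\|_{L^2}+\|D_x^{\frac14(1-\alpha)+\delta}\phi\|_{L^2}+\|D_y^\delta\phi\|_{L^2}+\|D_x^{\frac14(1-\alpha)}D_y^\delta\phi\|_{L^2}\right),$$ all norms on the right being those of $L^2(\mathbb{R}^2)$. -/

import Mathlib

open MeasureTheory
open scoped ENNReal FourierTransform

noncomputable section

/-- The plane `ℝ²` with its Euclidean structure; the coordinates of `z` are `x = z 0`, `y = z 1`. -/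
abbrev Plane : Type := EuclideanSpace ℝ (Fin 2)

/-- The space `L²(ℝ²)` of complex-valued functions. -/
abbrev L2Plane : Type := Lp ℂ 2 (volume : Measure Plane)

/-- A symbol `m(ξ, η)`, given in the angular frequency variables `(ξ, η)` (those for which the
plane waves are `exp (i (x ξ + y η))`), as a function of the frequency variable `ζ` of Mathlib's
Fourier transform, whose plane waves are `exp (2 π i ⟨z, ζ⟩)`; that is, `(ξ, η) = 2 π ζ`. -/
def angularSymbol (m : ℝ → ℝ → ℂ) (ζ : Plane) : ℂ :=
  m (2 * Real.pi * ζ 0) (2 * Real.pi * ζ 1)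

/-- `φ` lies in the natural `L²` domain of the Fourier multiplier with symbol `m`:
`m(ξ, η) φ̂(ξ, η)` is square integrable. -/
def InMultiplierDomain (m : ℝ → ℝ → ℂ) (φ : L2Plane) : Prop :=
  MemLp (fun ζ : Plane => angularSymbol m ζ * (𝓕 φ : L2Plane) ζ) 2 volume

/-- The Fourier multiplier with symbol `m` applied to an element `φ` of its domain: the function
in `L²(ℝ²)` whose Fourier transform is `m(ξ, η) φ̂(ξ, η)`. -/
def fourierMultiplier (m : ℝ → ℝ → ℂ) (φ : L2Plane) (h : InMultiplierDomain m φ) : L2Plane :=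
  𝓕⁻ (MemLp.toLp _ h : L2Plane)

/-- The symbol `|ξ|^s` of `D_x^s`. -/
def symbolDx (s : ℝ) (ξ _η : ℝ) : ℂ := ((|ξ| ^ s : ℝ) : ℂ)

/-- The symbol `|η|^s` of `D_y^s`. -/
def symbolDy (s : ℝ) (_ξ η : ℝ) : ℂ := ((|η| ^ s : ℝ) : ℂ)

/-- `D_x^s φ ∈ L²(ℝ²)`. -/
def InDomainDx (s : ℝ) (φ : L2Plane) : Prop := InMultiplierDomain (symbolDx s) φ

/-- `D_y^s φ ∈ L²(ℝ²)`. -/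
def InDomainDy (s : ℝ) (φ : L2Plane) : Prop := InMultiplierDomain (symbolDy s) φ

/-- `D_x^s φ`, defined by `(D_x^s φ)^ (ξ, η) = |ξ|^s φ̂(ξ, η)`. -/
def Dx (s : ℝ) (φ : L2Plane) (h : InDomainDx s φ) : L2Plane := fourierMultiplier (symbolDx s) φ h

/-- `D_y^s φ`, defined by `(D_y^s φ)^ (ξ, η) = |η|^s φ̂(ξ, η)`. -/
def Dy (s : ℝ) (φ : L2Plane) (h : InDomainDy s φ) : L2Plane := fourierMultiplier (symbolDy s) φ h

/-- The symbol `exp (- i t (|ξ|^α ξ + sgn(ξ) η²))` of the linear group. -/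
def symbolU (α t : ℝ) (ξ η : ℝ) : ℂ :=
  Complex.exp (-Complex.I * (t : ℂ) * ((|ξ| ^ α * ξ + Real.sign ξ * η ^ 2 : ℝ) : ℂ))

theorem measurable_real_sign : Measurable Real.sign := by
  have h : Real.sign = fun r : ℝ => if r < 0 then (-1 : ℝ) else if 0 < r then 1 else 0 := by
    funext r; rfl
  rw [h]
  exact Measurable.ite measurableSet_Iio measurable_const
    (Measurable.ite measurableSet_Ioi measurable_const measurable_const)

theorem measurable_angularSymbol_symbolU (α t : ℝ) :
    Measurable (angularSymbol (symbolU α t)) := by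
  unfold angularSymbol symbolU
  have h0 : Measurable fun ζ : Plane => 2 * Real.pi * ζ 0 := by fun_prop
  have h1 : Measurable fun ζ : Plane => 2 * Real.pi * ζ 1 := by fun_prop
  have hs := measurable_real_sign.comp h0
  have ha : Measurable fun ζ : Plane => |2 * Real.pi * ζ 0| ^ α :=
    (continuous_abs.measurable.comp h0).pow_const α
  exact Complex.measurable_exp.comp (measurable_const.mul
    (Complex.measurable_ofReal.comp ((ha.mul h0).add (hs.mul (h1.pow_const 2)))))

theorem norm_symbolU (α t ξ η : ℝ) : ‖symbolU α t ξ η‖ = 1 := by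
  unfold symbolU
  have h : -Complex.I * (t : ℂ) * ((|ξ| ^ α * ξ + Real.sign ξ * η ^ 2 : ℝ) : ℂ)
      = ((-t * (|ξ| ^ α * ξ + Real.sign ξ * η ^ 2) : ℝ) : ℂ) * Complex.I := by
    push_cast; ring
  rw [h, Complex.norm_exp_ofReal_mul_I]

theorem inMultiplierDomain_symbolU (α t : ℝ) (φ : L2Plane) :
    InMultiplierDomain (symbolU α t) φ := by
  refine (Lp.memLp (𝓕 φ : L2Plane)).of_le
    ((measurable_angularSymbol_symbolU α t).aestronglyMeasurable.mul
      (Lp.aestronglyMeasurable _)) (Filter.Eventually.of_forall fun ζ => ?_)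
  simp only [norm_mul, angularSymbol, norm_symbolU, one_mul, le_refl]

/-- The group `U_α(t)` on `L²(ℝ²)`, defined by
`(U_α(t) φ)^ (ξ, η) = exp (- i t (|ξ|^α ξ + sgn(ξ) η²)) φ̂(ξ, η)`. -/
def U (α t : ℝ) (φ : L2Plane) : L2Plane :=
  fourierMultiplier (symbolU α t) φ (inMultiplierDomain_symbolU α t φ)

/-- The mixed norm `‖u‖_{L^p_T L^q_{xy}}`: the `L^p` norm over `t ∈ [0, T]` of the
`L^q(ℝ²)` norm of `u(t)`, as an element of `[0, ∞]`; for `q = ∞` the latter is the essential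
supremum. -/
def mixedNorm (p q : ℝ≥0∞) (T : ℝ) (u : ℝ → Plane → ℂ) : ℝ≥0∞ :=
  eLpNorm (fun t : ℝ => eLpNorm (u t) q (volume : Measure Plane)) p
    ((volume : Measure ℝ).restrict (Set.Icc 0 T))

end

/-! The estimate is a maximal `T T*` argument based on a weighted dispersive bound. Since `|ξ|^α ξ +
sgn(ξ) η² = sgn(ξ) (|ξ|^(1+α) + η²)`, on each half plane `±ξ > 0` the phase separates, and the
kernel with weight `|ξ|^(-κ) |η|^(-δ)`, `κ = (1-α)/2 + δ`, is a sum of products of one-dimensional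
integrals. Van der Corput's lemma and a dyadic sum bound these by `|t|^(-1/2 + δ/(1+α))` and
`|t|^(-1/2 + δ/2)`, uniformly in space (`norm_integral_rpow_mul_exp_le`). The product is
`|t|^(-1+e)` with `e = δ/(1+α) + δ/2 > 0`, which is integrable at `t = 0`.

Evaluating the flow at `(t, z)` is pairing with a plane wave carrying half the weight; the Gram
kernel of these vectors is the dispersive kernel. Its bound does not depend on the points, so a
point may be chosen for each time, and Schur's test bounds the square function of the supremum by
`T^e` (`lintegral_iSup_enorm_inner_sq_le`). A square root gives `T^(e/2)`.

The other half of the weight falls on the data: with `s = (1-α)/4`, `|ξ|^(s+δ/2) |η|^(δ/2) ≤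
|ξ|^(s+δ) + |ξ|^s |η|^δ`, so two of the four norms suffice. Frequencies are first truncated away
from zero and infinity, which puts the weight in `L²` and makes the Fourier integrals converge;
lower semicontinuity of the sup norm and Fatou's lemma remove the truncation. -/

/-! ### Van der Corput estimates. -/

/-- Integration by parts: the boundary terms give `2 M P`, and since `ρ` is monotone its total
variation is `|ρ b - ρ a| ≤ 2 P`. -/
theorem norm_integral_mul_le_of_deriv_sign {a b : ℝ} (hab : a ≤ b) {F f : ℝ → ℂ}
    {ρ ρ' : ℝ → ℝ} {M P : ℝ}
    (hF : ∀ u ∈ Set.Icc a b, HasDerivAt F (f u) u) (hf : ContinuousOn f (Set.Icc a b))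
    (hρ : ∀ u ∈ Set.Icc a b, HasDerivAt ρ (ρ' u) u) (hρ' : ContinuousOn ρ' (Set.Icc a b))
    (hM : ∀ u ∈ Set.Icc a b, ‖F u‖ ≤ M) (hP : ∀ u ∈ Set.Icc a b, |ρ u| ≤ P)
    (hs : (∀ u ∈ Set.Icc a b, 0 ≤ ρ' u) ∨ (∀ u ∈ Set.Icc a b, ρ' u ≤ 0)) :
    ‖∫ u in a..b, (ρ u : ℂ) * f u‖ ≤ 4 * M * P := by
  have hI : Set.uIcc a b = Set.Icc a b := Set.uIcc_of_le hab
  have ha : a ∈ Set.Icc a b := ⟨le_rfl, hab⟩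
  have hb : b ∈ Set.Icc a b := ⟨hab, le_rfl⟩
  have hM0 : 0 ≤ M := (norm_nonneg _).trans (hM a ha)
  have hP0 : 0 ≤ P := (abs_nonneg _).trans (hP a ha)
  have hρi : IntervalIntegrable ρ' volume a b := (hI ▸ hρ').intervalIntegrable
  have hparts := intervalIntegral.integral_mul_deriv_eq_deriv_mul
    (u := fun u => (ρ u : ℂ)) (v := F) (u' := fun u => (ρ' u : ℂ)) (v' := f)
    (fun u hu => (hρ u (hI ▸ hu)).ofReal_comp) (fun u hu => hF u (hI ▸ hu))
    (Complex.continuous_ofReal.comp_continuousOn (hI ▸ hρ')).intervalIntegrable (hI ▸ hf).intervalIntegrable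
  rw [hparts]
  have hint : ∫ u in a..b, ρ' u = ρ b - ρ a :=
    intervalIntegral.integral_eq_sub_of_hasDerivAt (fun u hu => hρ u (hI ▸ hu)) hρi
  have hmain : ∀ σ : ℝ, |σ| = 1 → (∀ u ∈ Set.Icc a b, |ρ' u| = σ * ρ' u) →
      ‖∫ u in a..b, (ρ' u : ℂ) * F u‖ ≤ 2 * M * P := by
    intro σ hσ1 hσ
    have h1 : ‖∫ u in a..b, (ρ' u : ℂ) * F u‖ ≤ ∫ u in a..b, (σ * ρ' u) * M := by
      refine intervalIntegral.norm_integral_le_of_norm_le hab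
        (Filter.Eventually.of_forall fun u hu => ?_) ((hρi.const_mul σ).mul_const M)
      have hu' := Set.Ioc_subset_Icc_self hu
      rw [norm_mul, Complex.norm_real, Real.norm_eq_abs, ← hσ u hu']
      exact mul_le_mul_of_nonneg_left (hM u hu') (abs_nonneg _)
    refine h1.trans ?_
    rw [intervalIntegral.integral_mul_const, intervalIntegral.integral_const_mul, hint]
    have h2 : σ * (ρ b - ρ a) ≤ 2 * P := by
      calc σ * (ρ b - ρ a) ≤ |σ * (ρ b - ρ a)| := le_abs_self _
        _ = |ρ b - ρ a| := by rw [abs_mul, hσ1, one_mul]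
        _ ≤ |ρ b| + |ρ a| := abs_sub _ _
        _ ≤ 2 * P := by linarith [hP a ha, hP b hb]
    nlinarith
  have h3 : ‖∫ u in a..b, (ρ' u : ℂ) * F u‖ ≤ 2 * M * P := by
    rcases hs with hs | hs
    · exact hmain 1 (by simp) fun u hu => by rw [abs_of_nonneg (hs u hu), one_mul]
    · exact hmain (-1) (by simp) fun u hu => by rw [abs_of_nonpos (hs u hu)]; ring
  have hend : ∀ u ∈ Set.Icc a b, ‖(ρ u : ℂ) * F u‖ ≤ M * P := fun u hu => by
    rw [norm_mul, Complex.norm_real, Real.norm_eq_abs, mul_comm M]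
    exact mul_le_mul (hP u hu) (hM u hu) (norm_nonneg _) hP0
  calc _ ≤ ‖(ρ b : ℂ) * F b‖ + ‖(ρ a : ℂ) * F a‖ + ‖∫ u in a..b, (ρ' u : ℂ) * F u‖ :=
        (norm_sub_le _ _).trans (add_le_add_left (norm_sub_le _ _) _)
    _ ≤ _ := by linarith [hend a ha, hend b hb]

/-- Van der Corput's first derivative test. -/
theorem norm_integral_exp_le_of_le_abs_deriv {a b lam : ℝ} (hab : a ≤ b) (hlam : 0 < lam)
    {ψ ψ' ψ'' : ℝ → ℝ} (h1 : ∀ u ∈ Set.Icc a b, HasDerivAt ψ (ψ' u) u)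
    (h2 : ∀ u ∈ Set.Icc a b, HasDerivAt ψ' (ψ'' u) u) (hc : ContinuousOn ψ'' (Set.Icc a b))
    (hn : ∀ u ∈ Set.Icc a b, ψ'' u ≤ 0) (hl : ∀ u ∈ Set.Icc a b, lam ≤ |ψ' u|) :
    ‖∫ u in a..b, Complex.exp ((ψ u : ℂ) * Complex.I)‖ ≤ 4 / lam := by
  have hne : ∀ u ∈ Set.Icc a b, ψ' u ≠ 0 := fun u hu h => by
    have := hl u hu; rw [h, abs_zero] at this; linarith
  have hc1 : ContinuousOn ψ' (Set.Icc a b) := fun u hu => (h2 u hu).continuousAt.continuousWithinAt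
  have hc0 : ContinuousOn ψ (Set.Icc a b) := fun u hu => (h1 u hu).continuousAt.continuousWithinAt
  -- Split `exp(iψ)` as `(1/ψ') · (ψ' exp(iψ))`; the second factor has a primitive of modulus one,
  -- and `1/ψ'` is monotone because `ψ'' ≤ 0`.
  have key := norm_integral_mul_le_of_deriv_sign hab (M := 1) (P := 1 / lam)
    (F := fun u => -Complex.I * Complex.exp ((ψ u : ℂ) * Complex.I))
    (f := fun u => (ψ' u : ℂ) * Complex.exp ((ψ u : ℂ) * Complex.I))
    (ρ := fun u => (ψ' u)⁻¹) (ρ' := fun u => -ψ'' u / ψ' u ^ 2)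
    (fun u hu => by
      have := (((h1 u hu).ofReal_comp.mul_const Complex.I).cexp).const_mul (-Complex.I)
      convert! this using 1
      linear_combination ((ψ' u : ℂ) * Complex.exp ((ψ u : ℂ) * Complex.I)) * Complex.I_sq)
    (by
      have h := Complex.continuous_ofReal.comp_continuousOn hc0
      have h' := Complex.continuous_ofReal.comp_continuousOn hc1
      exact h'.mul (h.mul continuousOn_const).cexp)
    (fun u hu => (h2 u hu).inv (hne u hu))
    (hc.neg.div (hc1.pow 2) fun u hu => pow_ne_zero 2 (hne u hu))
    (fun u _ => by rw [norm_mul, Complex.norm_exp_ofReal_mul_I]; simp)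
    (fun u hu => by
      rw [abs_inv, ← one_div]; exact one_div_le_one_div_of_le hlam (hl u hu))
    (Or.inl fun u hu => div_nonneg (neg_nonneg.2 (hn u hu)) (sq_nonneg _))
  have heq : ∫ u in a..b, (((ψ' u)⁻¹ : ℝ) : ℂ) * ((ψ' u : ℂ) * Complex.exp ((ψ u : ℂ) * Complex.I))
      = ∫ u in a..b, Complex.exp ((ψ u : ℂ) * Complex.I) := by
    refine intervalIntegral.integral_congr fun u hu => ?_
    rw [Set.uIcc_of_le hab] at hu
    have : (ψ' u : ℂ) ≠ 0 := by exact_mod_cast hne u hu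
    push_cast
    field_simp
  rw [heq] at key
  calc _ ≤ _ := key
    _ = _ := by ring

/-- Van der Corput's second derivative test, for a concave phase. -/
theorem norm_integral_exp_le_of_deriv_two_le {a b m : ℝ} (hab : a ≤ b) (hm : 0 < m)
    {ψ ψ' ψ'' : ℝ → ℝ} (h1 : ∀ u ∈ Set.Icc a b, HasDerivAt ψ (ψ' u) u)
    (h2 : ∀ u ∈ Set.Icc a b, HasDerivAt ψ' (ψ'' u) u) (hc : ContinuousOn ψ'' (Set.Icc a b))
    (hn : ∀ u ∈ Set.Icc a b, ψ'' u ≤ -m ^ 2) :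
    ‖∫ u in a..b, Complex.exp ((ψ u : ℂ) * Complex.I)‖ ≤ 10 / m := by
  have hc1 : ContinuousOn ψ' (Set.Icc a b) := fun u hu => (h2 u hu).continuousAt.continuousWithinAt
  have hc0 : ContinuousOn ψ (Set.Icc a b) := fun u hu => (h1 u hu).continuousAt.continuousWithinAt
  have hslope : ∀ u ∈ Set.Icc a b, ∀ v ∈ Set.Icc a b, u ≤ v → ψ' v - ψ' u ≤ -m ^ 2 * (v - u) := by
    refine (convex_Icc a b).image_sub_le_mul_sub_of_deriv_le hc1 (fun u hu => ?_) fun u hu => ?_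
    · exact (h2 u (interior_subset hu)).differentiableAt.differentiableWithinAt
    · rw [(h2 u (interior_subset hu)).deriv]; exact hn u (interior_subset hu)
  -- The decreasing function `ψ'` is nonnegative before `c` and nonpositive after it; `c` is an
  -- endpoint when there is no interior sign change.
  obtain ⟨c, hcm, hcl, hcr⟩ : ∃ c ∈ Set.Icc a b, (c = a ∨ 0 ≤ ψ' c) ∧ (c = b ∨ ψ' c ≤ 0) := by
    by_cases ha : ψ' a ≤ 0
    · exact ⟨a, ⟨le_rfl, hab⟩, Or.inl rfl, Or.inr ha⟩
    by_cases hb : 0 ≤ ψ' b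
    · exact ⟨b, ⟨hab, le_rfl⟩, Or.inr hb, Or.inl rfl⟩
    push Not at ha hb
    obtain ⟨c, hc, hc0⟩ := intermediate_value_Icc' hab hc1 ⟨hb.le, ha.le⟩
    exact ⟨c, hc, Or.inr hc0.ge, Or.inr hc0.le⟩
  -- Beyond distance `h` from `c` one has `|ψ'| ≥ m² h = m`, so the first derivative test gives
  -- `4/m` on each side; the middle has length at most `2/m`.
  set h := 1 / m with hh
  have hpos : 0 < h := by positivity
  have hmh : m ^ 2 * h = m := by rw [hh]; field_simp
  set p := max a (c - h) with hp
  set q := min b (c + h) with hq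
  have hap : a ≤ p := le_max_left _ _
  have hqb : q ≤ b := min_le_left _ _
  have hpc : p ≤ c := max_le hcm.1 (by linarith)
  have hcq : c ≤ q := le_min hcm.2 (by linarith)
  have hpb : p ≤ b := hpc.trans hcm.2
  have haq : a ≤ q := hcm.1.trans hcq
  have hpq : p ≤ q := hpc.trans hcq
  have hint : ∀ x y, a ≤ x → x ≤ y → y ≤ b →
      IntervalIntegrable (fun u => Complex.exp ((ψ u : ℂ) * Complex.I)) volume x y := by
    intro x y hax hxy hyb
    refine ContinuousOn.intervalIntegrable ?_
    rw [Set.uIcc_of_le hxy]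
    exact ((Complex.continuous_ofReal.comp_continuousOn
      (hc0.mono (Set.Icc_subset_Icc hax hyb))).mul continuousOn_const).cexp
  have hleft : ‖∫ u in a..p, Complex.exp ((ψ u : ℂ) * Complex.I)‖ ≤ 4 / m := by
    rcases hap.eq_or_lt with he | hlt
    · rw [← he, intervalIntegral.integral_same, norm_zero]; positivity
    have hpe : p = c - h := by
      rcases max_choice a (c - h) with h' | h'
      · exact absurd (hp.trans h') hlt.ne'
      · exact h'
    have hψc : 0 ≤ ψ' c := hcl.resolve_left fun h => by linarith
    have hsub : Set.Icc a p ⊆ Set.Icc a b := Set.Icc_subset_Icc le_rfl hpb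
    refine norm_integral_exp_le_of_le_abs_deriv hap hm (fun u hu => h1 u (hsub hu))
      (fun u hu => h2 u (hsub hu)) (hc.mono hsub)
      (fun u hu => (hn u (hsub hu)).trans (by nlinarith)) fun u hu => ?_
    have := hslope u (hsub hu) c hcm (hu.2.trans hpc)
    refine le_trans ?_ (le_abs_self _)
    have h3 : h ≤ c - u := by linarith [hu.2]
    nlinarith [sq_nonneg m]
  have hright : ‖∫ u in q..b, Complex.exp ((ψ u : ℂ) * Complex.I)‖ ≤ 4 / m := by
    rcases hqb.eq_or_lt with he | hlt
    · rw [he, intervalIntegral.integral_same, norm_zero]; positivity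
    have hqe : q = c + h := by
      rcases min_choice b (c + h) with h' | h'
      · exact absurd (hq.trans h') hlt.ne
      · exact h'
    have hψc : ψ' c ≤ 0 := hcr.resolve_left fun h => by linarith
    have hsub : Set.Icc q b ⊆ Set.Icc a b := Set.Icc_subset_Icc haq le_rfl
    refine norm_integral_exp_le_of_le_abs_deriv hqb hm (fun u hu => h1 u (hsub hu))
      (fun u hu => h2 u (hsub hu)) (hc.mono hsub)
      (fun u hu => (hn u (hsub hu)).trans (by nlinarith)) fun u hu => ?_
    have := hslope c hcm u (hsub hu) (hcq.trans hu.1)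
    refine le_trans ?_ (neg_le_abs _)
    have h3 : h ≤ u - c := by linarith [hu.1]
    nlinarith [sq_nonneg m]
  have hmid : ‖∫ u in p..q, Complex.exp ((ψ u : ℂ) * Complex.I)‖ ≤ 2 / m := by
    have h3 := intervalIntegral.norm_integral_le_of_norm_le_const (a := p) (b := q) (C := 1)
      (f := fun u => Complex.exp ((ψ u : ℂ) * Complex.I))
      (fun u _ => (Complex.norm_exp_ofReal_mul_I _).le)
    refine h3.trans ?_
    rw [one_mul, abs_of_nonneg (by linarith)]
    have h4 : q ≤ c + h := min_le_right _ _
    have h5 : c - h ≤ p := le_max_right _ _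
    have : 2 / m = 2 * h := by rw [hh]; ring
    linarith
  rw [← intervalIntegral.integral_add_adjacent_intervals (hint a p le_rfl hap hpb)
    (hint p b hap hpb le_rfl), ← intervalIntegral.integral_add_adjacent_intervals
    (hint p q hap hpq hqb) (hint q b haq hqb le_rfl)]
  calc _ ≤ 4 / m + (2 / m + 4 / m) :=
        (norm_add_le _ _).trans (add_le_add hleft ((norm_add_le _ _).trans (add_le_add hmid hright)))
    _ = 10 / m := by ring

/-! ### One-dimensional oscillatory integrals with a power weight. -/

theorem continuous_exp_linear_sub_rpow {γ : ℝ} (hγ : 0 ≤ γ) (x t : ℝ) :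
    Continuous fun u : ℝ => Complex.exp (((x * u - t * u ^ γ : ℝ) : ℂ) * Complex.I) := by
  have : Continuous fun u : ℝ => u ^ γ := Real.continuous_rpow_const hγ
  fun_prop

/-- Second derivative test: as `γ ≤ 2`, the power `u ^ (γ - 2)` is bounded below by its value at `2
v`. -/
theorem norm_integral_exp_linear_sub_rpow_le {γ t x v a b : ℝ} (hγ1 : 1 < γ) (hγ2 : γ ≤ 2)
    (ht : 0 < t) (hv : 0 < v) (hva : v ≤ a) (hab : a ≤ b) (hbv : b ≤ 2 * v) :
    ‖∫ u in a..b, Complex.exp (((x * u - t * u ^ γ : ℝ) : ℂ) * Complex.I)‖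
      ≤ 10 / √(t * γ * (γ - 1) * (2 * v) ^ (γ - 2)) := by
  have hpos : ∀ u ∈ Set.Icc a b, 0 < u := fun u hu => hv.trans_le (hva.trans hu.1)
  have hm : 0 < t * γ * (γ - 1) * (2 * v) ^ (γ - 2) := by
    have : 0 < γ - 1 := by linarith
    positivity
  refine norm_integral_exp_le_of_deriv_two_le (ψ := fun u => x * u - t * u ^ γ)
    (ψ' := fun u => x - t * (γ * u ^ (γ - 1)))
    (ψ'' := fun u => -(t * (γ * ((γ - 1) * u ^ (γ - 1 - 1))))) hab (Real.sqrt_pos.2 hm)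
    (fun u hu => ?_) (fun u hu => ?_) (fun u hu => ?_) fun u hu => ?_
  · have h1 := (hasDerivAt_id u).const_mul x
    have h2 := (Real.hasDerivAt_rpow_const (p := γ) (Or.inl (hpos u hu).ne')).const_mul t
    convert! h1.sub h2 using 1
    simp
  · have h2 := (((Real.hasDerivAt_rpow_const (p := γ - 1)
      (Or.inl (hpos u hu).ne')).const_mul γ).const_mul t).const_sub x
    exact h2
  · have := (Real.continuousAt_rpow_const u (γ - 1 - 1) (Or.inl (hpos u hu).ne'))
    exact (((this.const_mul _).const_mul _).const_mul _).neg.continuousWithinAt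
  · rw [Real.sq_sqrt hm.le, show γ - 1 - 1 = γ - 2 by ring]
    have : (2 * v) ^ (γ - 2) ≤ u ^ (γ - 2) :=
      Real.rpow_le_rpow_of_nonpos (hpos u hu) (hu.2.trans hbv) (by linarith)
    have h0 : 0 ≤ t * γ * (γ - 1) :=
      mul_nonneg (mul_nonneg ht.le (by linarith)) (by linarith)
    have := mul_le_mul_of_nonneg_left this h0
    linarith

theorem norm_integral_rpow_mul_exp_le_of_dyadic {γ t x v a b β : ℝ} (hγ1 : 1 < γ) (hγ2 : γ ≤ 2)
    (hβ : 0 ≤ β)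
    (ht : 0 < t) (hv : 0 < v) (hva : v ≤ a) (hab : a ≤ b) (hbv : b ≤ 2 * v) :
    ‖∫ u in a..b, ((u ^ (-β) : ℝ) : ℂ) *
        Complex.exp (((x * u - t * u ^ γ : ℝ) : ℂ) * Complex.I)‖
      ≤ 40 / √(t * γ * (γ - 1) * (2 * v) ^ (γ - 2)) * v ^ (-β) := by
  have hpos : ∀ u ∈ Set.Icc a b, 0 < u := fun u hu => hv.trans_le (hva.trans hu.1)
  have hcont := continuous_exp_linear_sub_rpow (by linarith : 0 ≤ γ) x t
  have key := norm_integral_mul_le_of_deriv_sign hab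
    (F := fun u => ∫ w in a..u, Complex.exp (((x * w - t * w ^ γ : ℝ) : ℂ) * Complex.I))
    (f := fun u => Complex.exp (((x * u - t * u ^ γ : ℝ) : ℂ) * Complex.I))
    (ρ := fun u => u ^ (-β)) (ρ' := fun u => -β * u ^ (-β - 1))
    (M := 10 / √(t * γ * (γ - 1) * (2 * v) ^ (γ - 2))) (P := v ^ (-β))
    (fun u _ => hcont.integral_hasStrictDerivAt a u |>.hasDerivAt)
    hcont.continuousOn
    (fun u hu => Real.hasDerivAt_rpow_const (Or.inl (hpos u hu).ne'))
    (fun u hu => ((Real.continuousAt_rpow_const u _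
      (Or.inl (hpos u hu).ne')).const_mul _).continuousWithinAt)
    (fun u hu => norm_integral_exp_linear_sub_rpow_le hγ1 hγ2 ht hv hva hu.1 (hu.2.trans hbv))
    (fun u hu => by
      rw [abs_of_nonneg (Real.rpow_nonneg (hpos u hu).le _)]
      exact Real.rpow_le_rpow_of_nonpos hv (hva.trans hu.1) (by linarith))
    (Or.inr fun u hu => mul_nonpos_of_nonpos_of_nonneg (by linarith)
      (Real.rpow_nonneg (hpos u hu).le _))
  refine key.trans_eq (by ring)

theorem intervalIntegrable_rpow_mul_exp {γ t x β a b : ℝ} (hγ : 0 ≤ γ) (ha : 0 < a) (hab : a ≤ b) :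
    IntervalIntegrable (fun u : ℝ => ((u ^ (-β) : ℝ) : ℂ) *
        Complex.exp (((x * u - t * u ^ γ : ℝ) : ℂ) * Complex.I)) volume a b := by
  refine ContinuousOn.intervalIntegrable ?_
  rw [Set.uIcc_of_le hab]
  refine ContinuousOn.mul (fun u hu => ?_) (continuous_exp_linear_sub_rpow hγ x t).continuousOn
  exact (Complex.continuous_ofReal.continuousAt.comp (Real.continuousAt_rpow_const u _
      (Or.inl (ha.trans_le hu.1).ne'))).continuousWithinAt

/-- Split at the scale `u₀ = t ^ (-1/γ)`. Below it the weight is integrated trivially, which needs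
`β < 1`, that is `δ < γ/2`. Above it a dyadic block at `v` contributes `t^(-1/2) v^(-δ)`, a
geometric series. Both bounds equal `t^(-1/2 + δ/γ)` at `u₀`, up to constants. -/
theorem norm_integral_rpow_mul_exp_le_of_pos {γ δ : ℝ} (hγ1 : 1 < γ) (hγ2 : γ ≤ 2) (hδ : 0 < δ)
    (hδγ : δ < γ / 2) : ∃ C : ℝ, 0 < C ∧ ∀ t x a b : ℝ, 0 < t → 0 < a → a ≤ b →
      ‖∫ u in a..b, ((u ^ (-((2 - γ) / 2 + δ)) : ℝ) : ℂ) *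
        Complex.exp (((x * u - t * u ^ γ : ℝ) : ℂ) * Complex.I)‖ ≤ C * t ^ (-1 / 2 + δ / γ) := by
  set β := (2 - γ) / 2 + δ with hβdef
  have hγ0 : 0 < γ := by linarith
  have hβ0 : 0 ≤ β := by rw [hβdef]; linarith
  have hβ1 : 0 < 1 - β := by rw [hβdef]; linarith
  have hg1 : 0 < γ - 1 := by linarith
  set D := 40 / √(γ * (γ - 1) * 2 ^ (γ - 2)) with hD
  have hDpos : 0 < D := by positivity
  have hr : (2 : ℝ) ^ (-δ) < 1 := Real.rpow_lt_one_of_one_lt_of_neg one_lt_two (by linarith)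
  -- The sum of the geometric series of ratio `2^(-δ)`; the identity `hDE` closes the induction over
  -- dyadic blocks.
  set E := D / (1 - (2 : ℝ) ^ (-δ)) with hE
  have hEpos : 0 < E := div_pos hDpos (by linarith)
  have hDE : D + E * (2 : ℝ) ^ (-δ) = E := by
    have : (1 - (2 : ℝ) ^ (-δ)) ≠ 0 := by linarith
    rw [hE]; field_simp; ring
  have hdy : ∀ t x v b : ℝ, 0 < t → 0 < v → v ≤ b → b ≤ 2 * v →
      ‖∫ u in v..b, ((u ^ (-β) : ℝ) : ℂ) *
        Complex.exp (((x * u - t * u ^ γ : ℝ) : ℂ) * Complex.I)‖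
          ≤ D * t ^ (-1 / 2 : ℝ) * v ^ (-δ) := by
    intro t x v b ht hv hvb hb
    refine (norm_integral_rpow_mul_exp_le_of_dyadic hγ1 hγ2 hβ0 ht hv le_rfl hvb hb).trans_eq ?_
    have h1 : t * γ * (γ - 1) * (2 * v) ^ (γ - 2)
        = (γ * (γ - 1) * 2 ^ (γ - 2)) * (t * v ^ (γ - 2)) := by
      rw [Real.mul_rpow zero_le_two hv.le]; ring
    have h2 : √(t * v ^ (γ - 2)) = t ^ (1 / 2 : ℝ) * v ^ ((γ - 2) / 2) := by
      rw [Real.sqrt_mul ht.le, Real.sqrt_eq_rpow, Real.sqrt_eq_rpow, ← Real.rpow_mul hv.le]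
      congr 2; ring
    have h3 : v ^ (-β) = v ^ ((γ - 2) / 2) * v ^ (-δ) := by
      rw [← Real.rpow_add hv]; congr 1; rw [hβdef]; ring
    have h4 : t ^ (-1 / 2 : ℝ) = (t ^ (1 / 2 : ℝ))⁻¹ := by
      rw [← Real.rpow_neg ht.le]; congr 1; ring
    have h5 : 0 < v ^ ((γ - 2) / 2) := Real.rpow_pos_of_pos hv _
    rw [h1, Real.sqrt_mul (by positivity), h2, h3, h4, hD]
    field_simp
  have hdyn : ∀ n : ℕ, ∀ t x v b : ℝ, 0 < t → 0 < v → v ≤ b → b ≤ 2 ^ n * v →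
      ‖∫ u in v..b, ((u ^ (-β) : ℝ) : ℂ) *
        Complex.exp (((x * u - t * u ^ γ : ℝ) : ℂ) * Complex.I)‖
          ≤ E * t ^ (-1 / 2 : ℝ) * v ^ (-δ) := by
    intro n
    induction n with
    | zero =>
      intro t x v b ht hv hvb hb
      rw [le_antisymm hvb (by simpa using hb), intervalIntegral.integral_same, norm_zero]
      have := hv.trans_le hvb
      positivity
    | succ n ih =>
      intro t x v b ht hv hvb hb
      have htp : 0 < t ^ (-1 / 2 : ℝ) := Real.rpow_pos_of_pos ht _
      have hvp : 0 < v ^ (-δ) := Real.rpow_pos_of_pos hv _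
      by_cases h2 : b ≤ 2 * v
      · refine (hdy t x v b ht hv hvb h2).trans ?_
        gcongr
        have := mul_pos hEpos (Real.rpow_pos_of_pos zero_lt_two (-δ))
        linarith
      · push Not at h2
        have hA := hdy t x v (2 * v) ht hv (by linarith) le_rfl
        have hB := ih t x (2 * v) b ht (by linarith) h2.le (by rw [pow_succ] at hb; linarith)
        rw [← intervalIntegral.integral_add_adjacent_intervals
          (intervalIntegrable_rpow_mul_exp hγ0.le hv (by linarith : v ≤ 2 * v))
          (intervalIntegrable_rpow_mul_exp hγ0.le (by linarith : 0 < 2 * v) h2.le)]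
        refine (norm_add_le _ _).trans ((add_le_add hA hB).trans_eq ?_)
        rw [Real.mul_rpow zero_le_two hv.le]
        linear_combination t ^ (-1 / 2 : ℝ) * v ^ (-δ) * hDE
  have hlarge : ∀ t x v b : ℝ, 0 < t → 0 < v → v ≤ b →
      ‖∫ u in v..b, ((u ^ (-β) : ℝ) : ℂ) *
        Complex.exp (((x * u - t * u ^ γ : ℝ) : ℂ) * Complex.I)‖
          ≤ E * t ^ (-1 / 2 : ℝ) * v ^ (-δ) := by
    intro t x v b ht hv hvb
    obtain ⟨n, hn⟩ := pow_unbounded_of_one_lt (b / v) one_lt_two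
    exact hdyn n t x v b ht hv hvb ((div_le_iff₀ hv).1 hn.le)
  have hsmall : ∀ t x a b : ℝ, 0 < a → a ≤ b →
      ‖∫ u in a..b, ((u ^ (-β) : ℝ) : ℂ) *
        Complex.exp (((x * u - t * u ^ γ : ℝ) : ℂ) * Complex.I)‖ ≤ b ^ (1 - β) / (1 - β) := by
    intro t x a b ha hab
    have h0 : ∫ u in a..b, u ^ (-β) = (b ^ (1 - β) - a ^ (1 - β)) / (1 - β) := by
      rw [integral_rpow (Or.inl (by linarith))]; congr 1 <;> ring_nf
    calc _ ≤ ∫ u in a..b, u ^ (-β) := by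
          refine intervalIntegral.norm_integral_le_of_norm_le hab
            (Filter.Eventually.of_forall fun u hu => ?_)
            (intervalIntegral.intervalIntegrable_rpow' (by linarith))
          rw [norm_mul, Complex.norm_exp_ofReal_mul_I, mul_one, Complex.norm_real,
            Real.norm_of_nonneg (Real.rpow_nonneg (ha.trans hu.1).le _)]
      _ ≤ _ := by
          rw [h0]
          gcongr
          linarith [Real.rpow_nonneg ha.le (1 - β)]
  refine ⟨1 / (1 - β) + E, by positivity, fun t x a b ht ha hab => ?_⟩
  have hu0 : 0 < t ^ (-1 / γ) := Real.rpow_pos_of_pos ht _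
  have htp : 0 < t ^ (-1 / 2 + δ / γ) := Real.rpow_pos_of_pos ht _
  have e1 : (t ^ (-1 / γ)) ^ (1 - β) = t ^ (-1 / 2 + δ / γ) := by
    rw [← Real.rpow_mul ht.le]; congr 1; rw [hβdef]; field_simp; ring
  have e2 : t ^ (-1 / 2 : ℝ) * (t ^ (-1 / γ)) ^ (-δ) = t ^ (-1 / 2 + δ / γ) := by
    rw [← Real.rpow_mul ht.le, ← Real.rpow_add ht]; congr 1; field_simp
  set u₀ := t ^ (-1 / γ) with hu₀
  have hS : ∀ b, 0 < b → b ≤ u₀ → b ^ (1 - β) / (1 - β) ≤ 1 / (1 - β) * t ^ (-1 / 2 + δ / γ) := by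
    intro b hb hbu
    rw [← e1, div_mul_eq_mul_div, one_mul]
    gcongr
  have hL : ∀ v, u₀ ≤ v → E * t ^ (-1 / 2 : ℝ) * v ^ (-δ) ≤ E * t ^ (-1 / 2 + δ / γ) := by
    intro v hv
    rw [← e2, mul_assoc]
    have : v ^ (-δ) ≤ u₀ ^ (-δ) := Real.rpow_le_rpow_of_nonpos hu0 hv (by linarith)
    gcongr
  have hc1 : 0 ≤ 1 / (1 - β) * t ^ (-1 / 2 + δ / γ) := by positivity
  have hc2 : 0 ≤ E * t ^ (-1 / 2 + δ / γ) := by positivity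
  rw [add_mul]
  rcases le_total b u₀ with hb | hb
  · linarith [(hsmall t x a b ha hab).trans (hS b (ha.trans_le hab) hb)]
  rcases le_total u₀ a with ha' | ha'
  · linarith [(hlarge t x a b ht ha hab).trans (hL a ha')]
  rw [← intervalIntegral.integral_add_adjacent_intervals
    (intervalIntegrable_rpow_mul_exp hγ0.le ha ha')
    (intervalIntegrable_rpow_mul_exp hγ0.le hu0 hb)]
  exact (norm_add_le _ _).trans (add_le_add ((hsmall t x a u₀ ha ha').trans (hS u₀ hu0 le_rfl))
    ((hlarge t x u₀ b ht hu0 hb).trans (hL u₀ le_rfl)))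

/-- A uniform estimate for the truncated oscillatory integrals with phase `x u - t u ^ γ`. -/
theorem norm_integral_rpow_mul_exp_le {γ δ : ℝ} (hγ1 : 1 < γ) (hγ2 : γ ≤ 2) (hδ : 0 < δ)
    (hδγ : δ < γ / 2) : ∃ C : ℝ, 0 < C ∧ ∀ t x a b : ℝ, t ≠ 0 → 0 < a → a ≤ b →
      ‖∫ u in a..b, ((u ^ (-((2 - γ) / 2 + δ)) : ℝ) : ℂ) *
        Complex.exp (((x * u - t * u ^ γ : ℝ) : ℂ) * Complex.I)‖ ≤ C * |t| ^ (-1 / 2 + δ / γ) := by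
  obtain ⟨C, hC, h⟩ := norm_integral_rpow_mul_exp_le_of_pos hγ1 hγ2 hδ hδγ
  refine ⟨C, hC, fun t x a b ht ha hab => ?_⟩
  rcases ht.lt_or_gt with ht | ht
  · rw [abs_of_neg ht]
    refine le_trans (le_of_eq ?_) (h (-t) (-x) a b (neg_pos.2 ht) ha hab)
    -- Conjugation reverses the signs of `t` and `x`, which reduces negative times to positive ones.
    rw [← Complex.norm_conj, intervalIntegral.integral_of_le hab, ← integral_conj,
      ← intervalIntegral.integral_of_le hab]
    congr 1
    refine intervalIntegral.integral_congr fun u _ => ?_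
    simp only [map_mul, ← Complex.exp_conj, Complex.conj_ofReal, Complex.conj_I]
    push_cast
    ring_nf
  · rw [abs_of_pos ht]; exact h t x a b ht ha hab

/-! ### Schur's test and the maximal `T T*` argument. -/

theorem ENNReal.mul_le_sq_add_sq (a b : ℝ≥0∞) : a * b ≤ a ^ 2 + b ^ 2 := by
  rcases le_total a b with h | h
  · calc a * b ≤ b * b := mul_le_mul_left h b
      _ = b ^ 2 := (sq b).symm
      _ ≤ _ := le_add_self
  · calc a * b ≤ a * a := mul_le_mul_right h a
      _ = a ^ 2 := (sq a).symm
      _ ≤ _ := le_self_add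

/-- Schur's test for a symmetric nonnegative kernel. -/
theorem lintegral_lintegral_mul_mul_le {X : Type*} [MeasurableSpace X] {μ : Measure X}
    [SFinite μ] {f : X → ℝ≥0∞} (hf : Measurable f) {h : X → X → ℝ≥0∞}
    (hh : Measurable (Function.uncurry h)) (hsymm : ∀ s t, h s t = h t s) {N : ℝ≥0∞}
    (hN : ∀ t, ∫⁻ s, h t s ∂μ ≤ N) :
    ∫⁻ t, f t * ∫⁻ s, f s * h t s ∂μ ∂μ ≤ 2 * N * ∫⁻ t, f t ^ 2 ∂μ := by
  have hht : ∀ t, Measurable (h t) := fun t => hh.of_uncurry_left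
  have hone : ∫⁻ t, ∫⁻ s, f t ^ 2 * h t s ∂μ ∂μ ≤ N * ∫⁻ t, f t ^ 2 ∂μ := by
    rw [← lintegral_const_mul _ (hf.pow_const 2)]
    refine lintegral_mono fun t => ?_
    rw [lintegral_const_mul _ (hht t), mul_comm N]
    exact mul_le_mul_right (hN t) _
  have htwo : ∫⁻ t, ∫⁻ s, f s ^ 2 * h t s ∂μ ∂μ ≤ N * ∫⁻ t, f t ^ 2 ∂μ := by
    rw [lintegral_lintegral_swap
      (((hf.comp measurable_snd).pow_const 2).mul hh).aemeasurable]
    refine le_trans (le_of_eq ?_) hone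
    exact lintegral_congr fun s => lintegral_congr fun t => by rw [hsymm]
  calc ∫⁻ t, f t * ∫⁻ s, f s * h t s ∂μ ∂μ
      = ∫⁻ t, ∫⁻ s, f t * (f s * h t s) ∂μ ∂μ :=
        lintegral_congr fun t => (lintegral_const_mul _ (hf.mul (hht t))).symm
    _ ≤ ∫⁻ t, (∫⁻ s, f t ^ 2 * h t s ∂μ + ∫⁻ s, f s ^ 2 * h t s ∂μ) ∂μ := by
        refine lintegral_mono fun t => ?_
        rw [← lintegral_add_left ((hht t).const_mul _)]
        refine lintegral_mono fun s => ?_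
        dsimp only
        rw [← mul_assoc, ← add_mul]
        exact mul_le_mul_left (ENNReal.mul_le_sq_add_sq _ _) _
    _ = ∫⁻ t, ∫⁻ s, f t ^ 2 * h t s ∂μ ∂μ + ∫⁻ t, ∫⁻ s, f s ^ 2 * h t s ∂μ ∂μ :=
        lintegral_add_left
          (Measurable.lintegral_prod_right' (((hf.comp measurable_fst).pow_const 2).mul hh)) _
    _ ≤ N * ∫⁻ t, f t ^ 2 ∂μ + N * ∫⁻ t, f t ^ 2 ∂μ := add_le_add hone htwo
    _ = _ := by ring

section TTStar

variable {H : Type*} [NormedAddCommGroup H] [InnerProductSpace ℂ H] [CompleteSpace H]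
  {X : Type*} [MeasurableSpace X] {μ : Measure X} [IsFiniteMeasure μ]

/-- The `T T*` argument: a bound for the Gram kernel of a bounded family of vectors in a Hilbert
space yields a square function estimate. -/
theorem lintegral_enorm_inner_sq_le {v : X → H} (hv : StronglyMeasurable v) {B : ℝ}
    (hB : ∀ t, ‖v t‖ ≤ B) {h : X → X → ℝ≥0∞} (hh : Measurable (Function.uncurry h))
    (hsymm : ∀ s t, h s t = h t s) {N : ℝ≥0∞} (hN : ∀ t, ∫⁻ s, h t s ∂μ ≤ N)
    (hK : ∀ t, ∀ᵐ s ∂μ, ‖inner ℂ (v t) (v s)‖ₑ ≤ h t s) (g : H) :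
    ∫⁻ t, ‖inner ℂ (v t) g‖ₑ ^ 2 ∂μ ≤ 2 * N * ‖g‖ₑ ^ 2 := by
  set G : X → ℂ := fun t => inner ℂ (v t) g with hG
  have hGm : StronglyMeasurable G := hv.inner stronglyMeasurable_const
  have hGb : ∀ t, ‖G t‖ ≤ B * ‖g‖ := fun t =>
    (norm_inner_le_norm _ _).trans (mul_le_mul_of_nonneg_right (hB t) (norm_nonneg g))
  have hint : Integrable (fun t => G t • v t) μ := by
    refine Integrable.of_bound (hGm.smul hv).aestronglyMeasurable (B * ‖g‖ * B)
      (Filter.Eventually.of_forall fun t => ?_)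
    rw [norm_smul]
    exact mul_le_mul (hGb t) (hB t) (norm_nonneg _) ((norm_nonneg _).trans (hGb t))
  -- `Φ` is the adjoint map applied to `G`. Then `J = ⟨g, Φ⟩ ≤ ‖g‖ ‖Φ‖`, while Schur's test gives
  -- `‖Φ‖² ≤ 2 N J`; hence `J² ≤ 2 N ‖g‖² J`.
  set Φ : H := ∫ t, G t • v t ∂μ with hΦ
  set J := ∫⁻ t, ‖G t‖ₑ ^ 2 ∂μ with hJ
  -- Finiteness is what allows `J` to be cancelled at the end; it is here that bounded vectors on a
  -- finite measure space are needed.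
  have hJfin : J ≠ ∞ := by
    refine ne_top_of_le_ne_top ?_ (lintegral_mono (g := fun _ => ENNReal.ofReal (B * ‖g‖) ^ 2)
      fun t => ?_)
    · rw [lintegral_const]
      exact ENNReal.mul_ne_top (ENNReal.pow_ne_top ENNReal.ofReal_ne_top) (measure_ne_top _ _)
    · have : ‖G t‖ₑ ≤ ENNReal.ofReal (B * ‖g‖) := by
        rw [← ofReal_norm]; exact ENNReal.ofReal_le_ofReal (hGb t)
      exact pow_le_pow_left' this 2
  have hJΦ : J ≤ ‖g‖ₑ * ‖Φ‖ₑ := by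
    have h1 : inner ℂ g Φ = ∫ t, ((‖G t‖ ^ 2 : ℝ) : ℂ) ∂μ := by
      rw [hΦ, ← integral_inner hint]
      refine integral_congr_ae (Filter.Eventually.of_forall fun t => ?_)
      dsimp only
      rw [inner_smul_right, ← inner_conj_symm, RCLike.mul_conj]
      push_cast; rfl
    have h2 : J = ‖inner ℂ g Φ‖ₑ := by
      rw [h1, integral_complex_ofReal, hJ, ← ofReal_norm, Complex.norm_real, Real.norm_of_nonneg
        (integral_nonneg fun t => sq_nonneg _), ofReal_integral_eq_lintegral_ofReal]
      · refine lintegral_congr fun t => ?_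
        rw [ENNReal.ofReal_pow (norm_nonneg _), ofReal_norm]
      · refine Integrable.of_bound (hGm.norm.pow 2).aestronglyMeasurable ((B * ‖g‖) ^ 2)
          (Filter.Eventually.of_forall fun t => ?_)
        rw [Real.norm_of_nonneg (sq_nonneg _)]
        exact pow_le_pow_left₀ (norm_nonneg _) (hGb t) 2
      · exact Filter.Eventually.of_forall fun t => sq_nonneg _
    rw [h2]
    rw [← ofReal_norm, ← ofReal_norm, ← ofReal_norm, ← ENNReal.ofReal_mul (norm_nonneg _)]
    exact ENNReal.ofReal_le_ofReal (norm_inner_le_norm _ _)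
  have hΦsq : ‖Φ‖ₑ ^ 2 ≤ 2 * N * J := by
    have h1 : ‖Φ‖ₑ ^ 2 = ‖inner ℂ Φ Φ‖ₑ := by
      rw [inner_self_eq_norm_sq_to_K, enorm_pow]
      simp [← ofReal_norm]
    have h2 : ∀ t, ‖inner ℂ (v t) Φ‖ₑ ≤ ∫⁻ s, ‖G s‖ₑ * h t s ∂μ := fun t => by
      rw [hΦ, ← integral_inner hint]
      refine (enorm_integral_le_lintegral_enorm _).trans (lintegral_mono_ae ?_)
      filter_upwards [hK t] with s hs
      rw [inner_smul_right, enorm_mul]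
      exact mul_le_mul_right hs _
    rw [h1]
    nth_rw 2 [hΦ]
    rw [← integral_inner hint]
    refine (enorm_integral_le_lintegral_enorm _).trans (le_trans (lintegral_mono fun t => ?_)
      (lintegral_lintegral_mul_mul_le hGm.enorm hh hsymm hN))
    rw [inner_smul_right, enorm_mul, ← inner_conj_symm, RCLike.enorm_conj]
    exact mul_le_mul_right (h2 t) _
  have hfin : J * J ≤ (2 * N * ‖g‖ₑ ^ 2) * J := by
    calc J * J ≤ (‖g‖ₑ * ‖Φ‖ₑ) * (‖g‖ₑ * ‖Φ‖ₑ) := mul_le_mul' hJΦ hJΦ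
      _ = ‖g‖ₑ ^ 2 * ‖Φ‖ₑ ^ 2 := by ring
      _ ≤ ‖g‖ₑ ^ 2 * (2 * N * J) := mul_le_mul_right hΦsq _
      _ = _ := by ring
  rcases eq_or_ne J 0 with h0 | h0
  · rw [h0]; exact zero_le
  · exact (ENNReal.mul_le_mul_iff_left h0 hJfin).1 hfin

/-- The maximal version of the `T T*` argument, for a sequence of families of vectors. -/
theorem lintegral_iSup_enorm_inner_sq_le {V : ℕ → X → H} (hV : ∀ i, StronglyMeasurable (V i))
    {B : ℝ} (hB : ∀ i t, ‖V i t‖ ≤ B) {h : X → X → ℝ≥0∞} (hh : Measurable (Function.uncurry h))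
    (hsymm : ∀ s t, h s t = h t s) {N : ℝ≥0∞} (hN : ∀ t, ∫⁻ s, h t s ∂μ ≤ N)
    (hK : ∀ t, ∀ᵐ s ∂μ, ∀ i j, ‖inner ℂ (V i t) (V j s)‖ₑ ≤ h t s) (g : H) :
    ∫⁻ t, ⨆ i, ‖inner ℂ (V i t) g‖ₑ ^ 2 ∂μ ≤ 2 * N * ‖g‖ₑ ^ 2 := by
  have hm : ∀ {v : X → H}, StronglyMeasurable v → Measurable fun t => ‖inner ℂ (v t) g‖ₑ ^ 2 :=
    fun hv => (hv.inner stronglyMeasurable_const).enorm.pow_const 2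
  -- Linearization of the supremum: a measurable choice of a maximizing index among the first `n +
  -- 1`. The kernel bound is uniform in the indices, so it passes to the selected family.
  have hsel : ∀ n : ℕ, ∃ v : X → H, StronglyMeasurable v ∧ (∀ t, ∃ j, v t = V j t) ∧
      ∀ i ≤ n, ∀ t, ‖inner ℂ (V i t) g‖ₑ ^ 2 ≤ ‖inner ℂ (v t) g‖ₑ ^ 2 := by
    intro n
    induction n with
    | zero => exact ⟨V 0, hV 0, fun t => ⟨0, rfl⟩, fun i hi t => by rw [Nat.le_zero.1 hi]⟩
    | succ n ih =>
      classical
      obtain ⟨v, hv, hj, hle⟩ := ih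
      set A := {t | ‖inner ℂ (v t) g‖ₑ ^ 2 < ‖inner ℂ (V (n + 1) t) g‖ₑ ^ 2} with hA
      refine ⟨fun t => if t ∈ A then V (n + 1) t else v t,
        StronglyMeasurable.ite (measurableSet_lt (hm hv) (hm (hV _))) (hV _) hv,
        fun t => ?_, fun i hi t => ?_⟩
      · by_cases ht : t ∈ A
        · exact ⟨n + 1, by simp only [ht, if_true]⟩
        · obtain ⟨j, hj⟩ := hj t
          exact ⟨j, by simp only [ht, if_false, hj]⟩
      · by_cases ht : t ∈ A
        · simp only [ht, if_true]
          rcases Nat.le_succ_iff.1 hi with hi | rfl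
          · exact (hle i hi t).trans (le_of_lt ht)
          · exact le_rfl
        · simp only [ht, if_false]
          rcases Nat.le_succ_iff.1 hi with hi | rfl
          · exact hle i hi t
          · exact not_lt.1 ht
  have hsup : ∀ t, ⨆ i, ‖inner ℂ (V i t) g‖ₑ ^ 2
      = ⨆ n, partialSups (fun i => ‖inner ℂ (V i t) g‖ₑ ^ 2) n := fun t =>
    (iSup_partialSups_eq _).symm
  simp_rw [hsup]
  rw [lintegral_iSup]
  · refine iSup_le fun n => ?_
    obtain ⟨v, hv, hj, hle⟩ := hsel n
    refine le_trans (lintegral_mono fun t => partialSups_le _ _ _ fun i hi => hle i hi t)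
      (lintegral_enorm_inner_sq_le (B := B) hv (fun t => ?_) hh hsymm hN (fun t => ?_) g)
    · obtain ⟨j, hj⟩ := hj t
      rw [hj]; exact hB j t
    · obtain ⟨i, hi⟩ := hj t
      filter_upwards [hK t] with s hs
      obtain ⟨j, hj⟩ := hj s
      rw [hi, hj]; exact hs i j
  · intro n
    simp_rw [partialSups_eq_biSup]
    exact Measurable.iSup fun i => Measurable.iSup fun _ => hm (hV i)
  · exact fun m n hmn t => (partialSups (fun i => ‖inner ℂ (V i t) g‖ₑ ^ 2)).monotone hmn

end TTStar

/-! ### The inverse Fourier transform on `L¹ ∩ L²`. -/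

section FourierL2

variable {V : Type*} [NormedAddCommGroup V] [InnerProductSpace ℝ V] [FiniteDimensional ℝ V]
  [MeasurableSpace V] [BorelSpace V]

theorem continuous_fourierInv_of_integrable {f : V → ℂ} (hf : Integrable f) :
    Continuous (𝓕⁻ f) := by
  rw [← Real.Lp.fourierTransformInv_toLp (memLp_one_iff_integrable.2 hf)]
  exact BoundedContinuousFunction.continuous _

/-- On `L¹ ∩ L²` the inverse Fourier transform of `L²` is given by the Fourier integral. -/
theorem coeFn_fourierInv_toLp {f : V → ℂ} (h1 : Integrable f) (h2 : MemLp f 2) :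
    ((𝓕⁻ (h2.toLp f) : Lp ℂ 2 (volume : Measure V)) : V → ℂ) =ᵐ[volume] 𝓕⁻ f := by
  refine ae_eq_of_integral_contDiff_smul_eq ((Lp.memLp _).locallyIntegrable one_le_two)
    (continuous_fourierInv_of_integrable h1).locallyIntegrable fun g hg hgc => ?_
  have hg₁ : HasCompactSupport (Complex.ofRealCLM ∘ g) := hgc.comp_left rfl
  have hg₂ : ContDiff ℝ (⊤ : ℕ∞) (Complex.ofRealCLM ∘ g) := by fun_prop
  set G := hg₁.toSchwartzMap hg₂ with hG
  have hGx : ∀ x, G x = (g x : ℂ) := fun x => rfl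
  -- Tested against a smooth compactly supported function, the `L²` transform is the distributional
  -- one, so it can be moved onto the test function; Fubini then moves it back onto `f` as an
  -- integral.
  have hleft : ∫ x, g x • (𝓕⁻ (h2.toLp f) : Lp ℂ 2 (volume : Measure V)) x
      = ∫ x, (𝓕⁻ G) x • f x := by
    calc _ = Lp.toTemperedDistribution (𝓕⁻ (h2.toLp f) : Lp ℂ 2 (volume : Measure V)) G := by
          rw [Lp.toTemperedDistribution_apply]; rfl
      _ = _ := by
          rw [← Lp.fourierInv_toTemperedDistribution_eq, TemperedDistribution.fourierInv_apply,
            Lp.toTemperedDistribution_apply]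
          refine integral_congr_ae ?_
          filter_upwards [h2.coeFn_toLp] with x hx
          rw [hx]
  rw [hleft]
  have hflip := VectorFourier.integral_fourierIntegral_smul_eq_flip (L := -innerₗ V)
    (μ := volume) (ν := volume) Real.continuous_fourierChar
    (by
      have : Continuous fun p : V × V => -(inner ℝ p.1 p.2) := (by fun_prop)
      exact this) G.integrable h1
  have hsymm : (-innerₗ V).flip = -innerₗ V := by
    ext x y; simp [real_inner_comm]
  rw [hsymm] at hflip
  rw [SchwartzMap.fourierInv_coe]
  exact hflip

end FourierL2

/-! ### Limits in `L²`. -/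

theorem ENNReal.sq_le_iff_le_rpow (x y : ℝ≥0∞) : x ^ 2 ≤ y ↔ x ≤ y ^ (2⁻¹ : ℝ) := by
  rw [← ENNReal.rpow_two, ENNReal.le_rpow_inv_iff two_pos]

/-- Lower semicontinuity of the sup norm with respect to convergence in `L²`. -/
theorem eLpNorm_top_sq_le_liminf_of_tendsto {X : Type*} [MeasurableSpace X] {μ : Measure X}
    {f : ℕ → Lp ℂ 2 μ} {g : Lp ℂ 2 μ} (h : Filter.Tendsto f Filter.atTop (nhds g))
    {b : ℕ → ℝ≥0∞} (hb : ∀ n, eLpNorm (f n) ∞ μ ^ 2 ≤ b n) :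
    eLpNorm g ∞ μ ^ 2 ≤ Filter.atTop.liminf b := by
  refine le_of_forall_gt fun c hc => ?_
  obtain ⟨d, hd, hdc⟩ := exists_between hc
  refine lt_of_le_of_lt ?_ hdc
  -- Pass to a subsequence with `b < d`, then to a further one converging almost everywhere.
  have hfreq := Filter.frequently_lt_of_liminf_lt (by isBoundedDefault) hd
  obtain ⟨φ, hφ, hlt⟩ := Filter.extraction_of_frequently_atTop hfreq
  obtain ⟨ψ, -, hae⟩ := (tendstoInMeasure_of_tendsto_Lp
    (h.comp hφ.tendsto_atTop)).exists_seq_tendsto_ae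
  rw [ENNReal.sq_le_iff_le_rpow]
  exact Lp.eLpNorm_le_of_ae_tendsto (u := Filter.atTop)
    (Filter.Eventually.of_forall fun n => (ENNReal.sq_le_iff_le_rpow _ _).1 ((hb _).trans (hlt (ψ n)).le))
    (fun n => Lp.aestronglyMeasurable _) hae

/-- Dominated convergence in `L²` for the product of a fixed function with bounded factors. -/
theorem tendsto_toLp_mul {X ι : Type*} [MeasurableSpace X] {l : Filter ι}
    [l.IsCountablyGenerated] {μ : Measure X} {u : ι → X → ℂ} {v : X → ℂ} {m : X → ℂ}
    (hm : MemLp m 2 μ) (hmm : Measurable m) (hu : ∀ y, Measurable (u y)) (hv : Measurable v)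
    (hub : ∀ y x, ‖u y x‖ ≤ 1) (hvb : ∀ x, ‖v x‖ ≤ 1)
    (hc : ∀ᵐ x ∂μ, Filter.Tendsto (fun y => u y x) l (nhds (v x)))
    (hmem : ∀ y, MemLp (fun x => u y x * m x) 2 μ) (hmem' : MemLp (fun x => v x * m x) 2 μ) :
    Filter.Tendsto (fun y => (hmem y).toLp (fun x => u y x * m x)) l
      (nhds (hmem'.toLp fun x => v x * m x)) := by
  have hnorm : ∀ y, ‖(hmem y).toLp (fun x => u y x * m x) - hmem'.toLp (fun x => v x * m x)‖
      = (∫⁻ x, ‖(u y x - v x) * m x‖ₑ ^ (2 : ℝ) ∂μ).toReal ^ (1 / 2 : ℝ) := by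
    intro y
    rw [← MemLp.toLp_sub, Lp.norm_toLp, ENNReal.toReal_rpow, eLpNorm_eq_lintegral_rpow_enorm_toReal
      two_ne_zero ENNReal.ofNat_ne_top]
    simp only [Pi.sub_apply, ← sub_mul, ENNReal.toReal_ofNat]
  rw [tendsto_iff_norm_sub_tendsto_zero]
  simp_rw [hnorm]
  have hlim : Filter.Tendsto (fun y => ∫⁻ x, ‖(u y x - v x) * m x‖ₑ ^ (2 : ℝ) ∂μ)
      l (nhds (∫⁻ _, 0 ∂μ)) := by
    refine tendsto_lintegral_filter_of_dominated_convergence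
      (fun x => (2 * ‖m x‖ₑ) ^ (2 : ℝ)) (Filter.Eventually.of_forall fun y => ?_)
      (Filter.Eventually.of_forall fun y => Filter.Eventually.of_forall fun x => ?_) ?_ ?_
    · exact (((hu y).sub hv).mul hmm).enorm.pow_const _
    · refine ENNReal.rpow_le_rpow ?_ zero_le_two
      rw [enorm_mul]
      refine mul_le_mul_left (enorm_sub_le.trans ?_) _
      have h1 : ∀ w : ℂ, ‖w‖ ≤ 1 → ‖w‖ₑ ≤ 1 := fun w hw => by
        rw [← ofReal_norm, ← ENNReal.ofReal_one]; exact ENNReal.ofReal_le_ofReal hw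
      exact (add_le_add (h1 _ (hub y x)) (h1 _ (hvb x))).trans_eq one_add_one_eq_two
    · have h2 := lintegral_rpow_enorm_lt_top_of_eLpNorm_lt_top two_ne_zero ENNReal.ofNat_ne_top
        hm.2
      simp_rw [ENNReal.mul_rpow_of_nonneg _ _ zero_le_two]
      rw [lintegral_const_mul' _ _ (by simp)]
      exact ENNReal.mul_ne_top (by simp) h2.ne
    · filter_upwards [hc] with x hx
      have h3 : Continuous fun w : ℂ => ‖(w - v x) * m x‖ₑ ^ (2 : ℝ) :=
        ENNReal.continuous_rpow_const.comp
          ((continuous_id.sub continuous_const).mul continuous_const).enorm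
      simpa [Function.comp_def] using (h3.tendsto (v x)).comp hx
  rw [lintegral_zero] at hlim
  have := ((ENNReal.tendsto_toReal ENNReal.zero_ne_top).comp hlim).rpow_const
    (p := (1 / 2 : ℝ)) (Or.inr (by norm_num))
  simpa using this

/-! ### Truncated plane waves and the dispersive estimate. -/

/-- The integrand of the truncated oscillatory integral on a half line. -/
noncomputable def halfWave (γ β a b x t : ℝ) : ℝ → ℂ :=
  (Set.Icc a b).indicator fun u => ((u ^ (-β) : ℝ) : ℂ) *
    Complex.exp (((x * u - t * u ^ γ : ℝ) : ℂ) * Complex.I)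

theorem integrable_halfWave {γ β a b x t : ℝ} (hγ : 0 ≤ γ) (ha : 0 < a) (hab : a ≤ b) :
    Integrable (halfWave γ β a b x t) := by
  refine (integrable_indicator_iff measurableSet_Icc).2 ?_
  rw [integrableOn_Icc_iff_integrableOn_Ioc]
  exact (intervalIntegrable_iff_integrableOn_Ioc_of_le hab).1
    (intervalIntegrable_rpow_mul_exp hγ ha hab)

theorem integral_halfWave {γ β a b x t : ℝ} (hab : a ≤ b) :
    ∫ u, halfWave γ β a b x t u = ∫ u in a..b, ((u ^ (-β) : ℝ) : ℂ) *
      Complex.exp (((x * u - t * u ^ γ : ℝ) : ℂ) * Complex.I) := by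
  rw [halfWave, integral_indicator measurableSet_Icc, integral_Icc_eq_integral_Ioc,
    intervalIntegral.integral_of_le hab]

/-- The character `exp (i (x ξ + y η) - i t (|ξ|^α ξ + sgn(ξ) η²))` in the variable `ζ`. -/
noncomputable def planeWave (α t : ℝ) (z ζ : Plane) : ℂ :=
  Complex.exp ((2 * Real.pi * inner ℝ ζ z : ℝ) * Complex.I) * angularSymbol (symbolU α t) ζ

/-- Truncation away from zero and infinity. -/
noncomputable def cutoff (a b u : ℝ) : ℝ := (Set.Icc a b).indicator 1 |u|

/-- The truncated homogeneous weight `|ζ₀| ^ (-κ) |ζ₁| ^ (-δ)`. -/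
noncomputable def truncWeight (κ δ a b : ℝ) (ζ : Plane) : ℝ :=
  cutoff a b (ζ 0) * cutoff a b (ζ 1) * (|ζ 0| ^ (-κ) * |ζ 1| ^ (-δ))

theorem norm_planeWave (α t : ℝ) (z ζ : Plane) : ‖planeWave α t z ζ‖ = 1 := by
  rw [planeWave, norm_mul, Complex.norm_exp_ofReal_mul_I, angularSymbol, norm_symbolU, one_mul]

theorem planeWave_eq (α t : ℝ) (z ζ : Plane) : planeWave α t z ζ =
    Complex.exp (((2 * Real.pi * (ζ 0 * z 0 + ζ 1 * z 1) -
      t * (|2 * Real.pi * ζ 0| ^ α * (2 * Real.pi * ζ 0)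
        + Real.sign (2 * Real.pi * ζ 0) * (2 * Real.pi * ζ 1) ^ 2) : ℝ) : ℂ) * Complex.I) := by
  rw [planeWave, angularSymbol, symbolU, ← Complex.exp_add]
  congr 1
  have : inner ℝ ζ z = ζ 0 * z 0 + ζ 1 * z 1 := by
    simp [PiLp.inner_apply, Fin.sum_univ_two, mul_comm]
  rw [this]
  push_cast
  ring

theorem planeWave_mul_conj (α t t' : ℝ) (z z' ζ : Plane) :
    planeWave α t z ζ * (starRingEnd ℂ) (planeWave α t' z' ζ) = planeWave α (t - t') (z - z') ζ := by
  simp only [planeWave_eq, ← Complex.exp_conj, ← Complex.exp_add, map_mul, Complex.conj_ofReal,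
    Complex.conj_I, PiLp.sub_apply]
  congr 1
  push_cast
  ring

theorem measurable_planeWave (α t : ℝ) (z : Plane) : Measurable (planeWave α t z) := by
  refine Measurable.mul ?_ (measurable_angularSymbol_symbolU α t)
  have : Continuous fun ζ : Plane =>
    Complex.exp ((2 * Real.pi * inner ℝ ζ z : ℝ) * Complex.I) := by fun_prop
  exact this.measurable

theorem continuous_planeWave_time (α : ℝ) (z ζ : Plane) : Continuous fun t => planeWave α t z ζ := by
  simp only [planeWave_eq]
  fun_prop

theorem measurable_cutoff (a b : ℝ) : Measurable (cutoff a b) :=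
  (measurable_one.indicator measurableSet_Icc).comp measurable_abs

theorem cutoff_of_mem {a b u : ℝ} (h : |u| ∈ Set.Icc a b) : cutoff a b u = 1 := by
  simp [cutoff, h]

theorem cutoff_of_notMem {a b u : ℝ} (h : |u| ∉ Set.Icc a b) : cutoff a b u = 0 := by
  simp [cutoff, h]

theorem cutoff_mul_self (a b u : ℝ) : cutoff a b u * cutoff a b u = cutoff a b u := by
  by_cases h : |u| ∈ Set.Icc a b
  · simp [cutoff_of_mem h]
  · simp [cutoff_of_notMem h]

theorem halfWave_eq_zero_of_nonpos {γ β a b x t u : ℝ} (ha : 0 < a) (hu : u ≤ 0) :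
    halfWave γ β a b x t u = 0 :=
  Set.indicator_of_notMem (fun h => by linarith [h.1]) _

theorem halfWave_abs {γ β a b x t u : ℝ} : halfWave γ β a b x t |u| = cutoff a b u *
    (((|u| ^ (-β) : ℝ) : ℂ) * Complex.exp (((x * |u| - t * |u| ^ γ : ℝ) : ℂ) * Complex.I)) := by
  by_cases h : |u| ∈ Set.Icc a b
  · rw [cutoff_of_mem h, halfWave, Set.indicator_of_mem h]; simp
  · rw [cutoff_of_notMem h, halfWave, Set.indicator_of_notMem h]; simp

theorem halfWave_of_nonneg {γ β a b x t u : ℝ} (hu : 0 ≤ u) :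
    halfWave γ β a b x t u = cutoff a b u *
    (((|u| ^ (-β) : ℝ) : ℂ) * Complex.exp (((x * |u| - t * |u| ^ γ : ℝ) : ℂ) * Complex.I)) := by
  rw [← halfWave_abs, abs_of_nonneg hu]

theorem halfWave_add_halfWave_neg {β a b x t : ℝ} (ha : 0 < a) (q : ℝ) :
    halfWave 2 β a b x t q + halfWave 2 β a b (-x) t (-q) = cutoff a b q *
    (((|q| ^ (-β) : ℝ) : ℂ) * Complex.exp (((x * q - t * q ^ 2 : ℝ) : ℂ) * Complex.I)) := by
  rcases le_total 0 q with hq | hq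
  · rw [halfWave_eq_zero_of_nonpos ha (neg_nonpos.2 hq), add_zero]
    nth_rw 1 [← abs_of_nonneg hq]
    rw [halfWave_abs]
    norm_num [abs_of_nonneg hq]
  · rw [halfWave_eq_zero_of_nonpos ha hq, zero_add, ← abs_of_nonpos hq, halfWave_abs]
    norm_num [abs_of_nonpos hq]

/-- Separation of variables. On `ζ 0 < 0` the phase is that of the reflected frequency with time
reversed, and each line in `ζ 1` splits into two half lines. On the axes everything vanishes because
`a > 0`. -/
theorem truncWeight_mul_planeWave {α κ δ a b t : ℝ} (ha : 0 < a) (z ζ : Plane) :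
    (truncWeight κ δ a b ζ : ℂ) * planeWave α t z ζ =
      halfWave (1 + α) κ a b (2 * Real.pi * z 0) (t * (2 * Real.pi) ^ (1 + α)) (ζ 0) *
        (halfWave 2 δ a b (2 * Real.pi * z 1) (t * (2 * Real.pi) ^ 2) (ζ 1) +
          halfWave 2 δ a b (-(2 * Real.pi * z 1)) (t * (2 * Real.pi) ^ 2) (-ζ 1)) +
      halfWave (1 + α) κ a b (-(2 * Real.pi * z 0)) (-t * (2 * Real.pi) ^ (1 + α)) (-ζ 0) *
        (halfWave 2 δ a b (2 * Real.pi * z 1) (-t * (2 * Real.pi) ^ 2) (ζ 1) +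
          halfWave 2 δ a b (-(2 * Real.pi * z 1)) (-t * (2 * Real.pi) ^ 2) (-ζ 1)) := by
  rw [halfWave_add_halfWave_neg ha, halfWave_add_halfWave_neg ha, planeWave_eq, truncWeight]
  have hpi := Real.two_pi_pos
  rcases lt_trichotomy (ζ 0) 0 with h0 | h0 | h0
  · rw [halfWave_eq_zero_of_nonpos ha h0.le, zero_mul, zero_add, ← abs_of_neg h0, halfWave_abs]
    have e1 : |2 * Real.pi * ζ 0| ^ α * (2 * Real.pi * ζ 0)
        = -((2 * Real.pi) ^ (1 + α) * |ζ 0| ^ (1 + α)) := by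
      have h2 : 0 < |ζ 0| := abs_pos.2 h0.ne
      rw [abs_mul, abs_of_pos hpi, Real.mul_rpow hpi.le h2.le, Real.rpow_add hpi,
        Real.rpow_add h2, Real.rpow_one, Real.rpow_one, abs_of_neg h0]
      ring
    have e2 : Real.sign (2 * Real.pi * ζ 0) = -1 :=
      Real.sign_of_neg (mul_neg_of_pos_of_neg hpi h0)
    rw [e1, e2]
    have e3 : ∀ A B : ℝ, Complex.exp (((2 * Real.pi * (ζ 0 * z 0 + ζ 1 * z 1) - t * (-A + -1 * B)
        : ℝ) : ℂ) * Complex.I) =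
        Complex.exp (((-(2 * Real.pi * z 0) * |ζ 0| - -t * A : ℝ) : ℂ) * Complex.I) *
        Complex.exp (((2 * Real.pi * z 1 * ζ 1 - -t * B : ℝ) : ℂ) * Complex.I) := by
      intro A B
      rw [← Complex.exp_add, ← add_mul, ← Complex.ofReal_add, abs_of_neg h0]
      congr 3; ring
    rw [e3, mul_assoc (-t) ((2 * Real.pi) ^ (1 + α)), mul_pow, mul_assoc (-t) ((2 * Real.pi) ^ 2)]
    push_cast
    ring
  · have h2 : |ζ 0| ∉ Set.Icc a b := by rw [h0, abs_zero]; exact fun h => by linarith [h.1]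
    rw [cutoff_of_notMem h2, halfWave_eq_zero_of_nonpos ha h0.le,
      halfWave_eq_zero_of_nonpos ha (by rw [h0, neg_zero])]
    simp
  · rw [halfWave_eq_zero_of_nonpos (x := -(2 * Real.pi * z 0)) ha (neg_nonpos.2 h0.le),
      zero_mul, add_zero]
    rw [halfWave_of_nonneg h0.le]
    have e1 : |2 * Real.pi * ζ 0| ^ α * (2 * Real.pi * ζ 0)
        = ((2 * Real.pi) ^ (1 + α) * |ζ 0| ^ (1 + α)) := by
      have h2 : 0 < |ζ 0| := abs_pos.2 h0.ne'
      rw [abs_mul, abs_of_pos hpi, Real.mul_rpow hpi.le h2.le, Real.rpow_add hpi,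
        Real.rpow_add h2, Real.rpow_one, Real.rpow_one, abs_of_pos h0]
      ring
    have e2 : Real.sign (2 * Real.pi * ζ 0) = 1 :=
      Real.sign_of_pos (mul_pos hpi h0)
    rw [e1, e2]
    have e3 : ∀ A B : ℝ, Complex.exp (((2 * Real.pi * (ζ 0 * z 0 + ζ 1 * z 1) - t * (A + 1 * B)
        : ℝ) : ℂ) * Complex.I) =
        Complex.exp ((((2 * Real.pi * z 0) * |ζ 0| - t * A : ℝ) : ℂ) * Complex.I) *
        Complex.exp (((2 * Real.pi * z 1 * ζ 1 - t * B : ℝ) : ℂ) * Complex.I) := by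
      intro A B
      rw [← Complex.exp_add, ← add_mul, ← Complex.ofReal_add, abs_of_pos h0]
      congr 3; ring
    rw [e3, mul_assoc t ((2 * Real.pi) ^ (1 + α)), mul_pow, mul_assoc t ((2 * Real.pi) ^ 2)]
    push_cast
    ring

theorem integral_plane_mul_add {f₁ g₁ f₂ g₂ : ℝ → ℂ} (hf₁ : Integrable f₁) (hg₁ : Integrable g₁)
    (hf₂ : Integrable f₂) (hg₂ : Integrable g₂) :
    ∫ ζ : Plane, (f₁ (ζ 0) * g₁ (ζ 1) + f₂ (ζ 0) * g₂ (ζ 1)) =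
      (∫ u, f₁ u) * (∫ u, g₁ u) + (∫ u, f₂ u) * ∫ u, g₂ u := by
  have e1 := (EuclideanSpace.volume_preserving_symm_measurableEquiv_toLp (Fin 2)).trans
    (volume_preserving_finTwoArrow ℝ)
  have e2 := e1.integral_comp
    (((MeasurableEquiv.toLp 2 (Fin 2 → ℝ)).symm.trans
      MeasurableEquiv.finTwoArrow).measurableEmbedding)
    (fun p : ℝ × ℝ => f₁ p.1 * g₁ p.2 + f₂ p.1 * g₂ p.2)
  rw [← integral_prod_mul, ← integral_prod_mul, ← integral_add (hf₁.mul_prod hg₁)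
    (hf₂.mul_prod hg₂)]
  exact e2

/-- The factor `(2π)^γ ≥ 1` from the frequency normalization only dilates time, and is harmless
because the exponent of `|t|` is nonpositive. -/
theorem norm_integral_halfWave_le {γ δ : ℝ} (hγ1 : 1 < γ) (hγ2 : γ ≤ 2) (hδ : 0 < δ)
    (hδγ : δ < γ / 2) : ∃ C : ℝ, 0 < C ∧ ∀ t x a b : ℝ, t ≠ 0 → 0 < a → a ≤ b →
      ‖∫ u, halfWave γ ((2 - γ) / 2 + δ) a b x (t * (2 * Real.pi) ^ γ) u‖
        ≤ C * |t| ^ (-1 / 2 + δ / γ) := by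
  obtain ⟨C, hC, h⟩ := norm_integral_rpow_mul_exp_le hγ1 hγ2 hδ hδγ
  refine ⟨C, hC, fun t x a b ht ha hab => ?_⟩
  have hp : 0 < (2 * Real.pi) ^ γ := Real.rpow_pos_of_pos Real.two_pi_pos _
  rw [integral_halfWave hab]
  refine (h _ x a b (mul_ne_zero ht hp.ne') ha hab).trans ?_
  have hneg : -1 / 2 + δ / γ ≤ 0 := by
    have : δ / γ < 1 / 2 := by rw [div_lt_iff₀ (by linarith)]; linarith
    linarith
  have hone : 1 ≤ (2 * Real.pi) ^ γ :=
    Real.one_le_rpow (by linarith [Real.pi_gt_three]) (by linarith)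
  refine mul_le_mul_of_nonneg_left ?_ hC.le
  rw [abs_mul, abs_of_pos hp]
  exact Real.rpow_le_rpow_of_nonpos (abs_pos.2 ht)
    (le_mul_of_one_le_right (abs_nonneg _) hone) hneg

/-- The dispersive estimate for the truncated kernel. -/
theorem norm_integral_truncWeight_mul_planeWave_le {α δ : ℝ} (hα₀ : 0 < α) (hα₁ : α ≤ 1)
    (hδ : 0 < δ) (hδ₁ : δ < 1 / 2) : ∃ C : ℝ, 0 < C ∧ ∀ (t : ℝ) (z : Plane) (a b : ℝ), t ≠ 0 →
      0 < a → a ≤ b →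
      ‖∫ ζ, (truncWeight ((1 - α) / 2 + δ) δ a b ζ : ℂ) * planeWave α t z ζ‖
        ≤ C * |t| ^ (-1 + (δ / (1 + α) + δ / 2)) := by
  obtain ⟨C₁, hC₁, h₁⟩ := norm_integral_halfWave_le (γ := 1 + α) (δ := δ) (by linarith)
    (by linarith) hδ (by linarith)
  obtain ⟨C₂, hC₂, h₂⟩ := norm_integral_halfWave_le (γ := 2) (δ := δ) one_lt_two le_rfl hδ
    (by linarith)
  rw [show (2 - (1 + α)) / 2 + δ = (1 - α) / 2 + δ by ring] at h₁
  rw [show (2 - 2) / 2 + δ = δ by ring] at h₂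
  simp only [Real.rpow_two] at h₂
  -- Two half planes, times two half lines in `ζ 1`.
  refine ⟨4 * (C₁ * C₂), by positivity, fun t z a b ht ha hab => ?_⟩
  have i1 : ∀ x s, Integrable (halfWave (1 + α) ((1 - α) / 2 + δ) a b x s) := fun x s =>
    integrable_halfWave (by linarith) ha hab
  have i2 : ∀ x s, Integrable (halfWave 2 δ a b x s) := fun x s =>
    integrable_halfWave zero_le_two ha hab
  have i3 : ∀ x y s, Integrable fun u => halfWave 2 δ a b x s u + halfWave 2 δ a b y s (-u) :=
    fun x y s => (i2 x s).add (i2 y s).comp_neg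
  have i4 : ∀ x s, Integrable fun u => halfWave (1 + α) ((1 - α) / 2 + δ) a b x s (-u) :=
    fun x s => (i1 x s).comp_neg
  simp_rw [truncWeight_mul_planeWave ha]
  rw [integral_plane_mul_add (i1 _ _) (i3 _ _ _) (i4 _ _) (i3 _ _ _),
    integral_neg_eq_self (halfWave (1 + α) ((1 - α) / 2 + δ) a b _ _)]
  have hB : ∀ s : ℝ, s ≠ 0 → ∀ x y : ℝ, ‖∫ u, (halfWave 2 δ a b x (s * (2 * Real.pi) ^ 2) u +
      halfWave 2 δ a b y (s * (2 * Real.pi) ^ 2) (-u))‖ ≤ 2 * C₂ * |s| ^ (-1 / 2 + δ / 2) := by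
    intro s hs x y
    rw [integral_add (i2 _ _) (i2 _ _).comp_neg, integral_neg_eq_self (halfWave 2 δ a b _ _)]
    exact (norm_add_le _ _).trans
      ((add_le_add (h₂ s x a b hs ha hab) (h₂ s y a b hs ha hab)).trans_eq (by ring))
  have ht' : 0 < |t| := abs_pos.2 ht
  have hmain : ∀ s : ℝ, |s| = |t| → s ≠ 0 → ∀ x y x' : ℝ,
      ‖(∫ u, halfWave (1 + α) ((1 - α) / 2 + δ) a b x' (s * (2 * Real.pi) ^ (1 + α)) u) *
        ∫ u, (halfWave 2 δ a b x (s * (2 * Real.pi) ^ 2) u +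
      halfWave 2 δ a b y (s * (2 * Real.pi) ^ 2) (-u))‖
        ≤ 2 * (C₁ * C₂) * |t| ^ (-1 + (δ / (1 + α) + δ / 2)) := by
    intro s hst hs x y x'
    rw [norm_mul]
    have e : |t| ^ (-1 + (δ / (1 + α) + δ / 2))
        = |t| ^ (-1 / 2 + δ / (1 + α)) * |t| ^ (-1 / 2 + δ / 2) := by
      rw [← Real.rpow_add ht']; congr 1; ring
    refine (mul_le_mul (h₁ s x' a b hs ha hab) (hB s hs x y) (norm_nonneg _)
      (by positivity)).trans_eq ?_
    rw [hst, e]; ring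
  refine (norm_add_le _ _).trans ((add_le_add (hmain t rfl ht _ _ _)
    (hmain (-t) (abs_neg t) (neg_ne_zero.2 ht) _ _ _)).trans_eq (by ring))

/-! ### The kernel in time and the weighted plane waves in `L²`. -/

/-- The two sides of `t` within distance `T` give `T^e / e` each; farther away the kernel is at most
`T^(-1+e)` on a set of measure at most `T`. Here `t` is any real number, as Schur's test is applied
with a bound for all `t`. -/
theorem lintegral_Icc_abs_sub_rpow_le {e T : ℝ} (he₀ : 0 < e) (he₁ : e ≤ 1) (hT : 0 < T) (t : ℝ) :
    ∫⁻ s in Set.Icc 0 T, ENNReal.ofReal (|t - s| ^ (-1 + e)) ≤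
      ENNReal.ofReal ((2 / e + 1) * T ^ e) := by
  set f : ℝ → ℝ≥0∞ := (Set.Icc 0 T).indicator fun u => ENNReal.ofReal (u ^ (-1 + e)) with hf
  have hfm : Measurable f :=
    (ENNReal.measurable_ofReal.comp (measurable_id.pow_const _)).indicator measurableSet_Icc
  have hfint : ∫⁻ u, f u = ENNReal.ofReal (T ^ e / e) := by
    have hi : IntervalIntegrable (fun u : ℝ => u ^ (-1 + e)) volume 0 T :=
      intervalIntegral.intervalIntegrable_rpow' (by linarith)
    rw [hf, lintegral_indicator measurableSet_Icc, ← Measure.restrict_congr_set Ioc_ae_eq_Icc,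
      ← ofReal_integral_eq_lintegral_ofReal, ← intervalIntegral.integral_of_le hT.le,
      integral_rpow (Or.inl (by linarith))]
    · congr 1
      rw [show -1 + e + 1 = e by ring, Real.zero_rpow he₀.ne', sub_zero]
    · exact (intervalIntegrable_iff_integrableOn_Ioc_of_le hT.le).1 hi
    · exact (ae_restrict_mem measurableSet_Ioc).mono fun u hu => Real.rpow_nonneg hu.1.le _
  have hpt : ∀ s, ENNReal.ofReal (|t - s| ^ (-1 + e)) ≤
      f (t - s) + f (s - t) + ENNReal.ofReal (T ^ (-1 + e)) := by
    intro s
    by_cases hs : |t - s| ≤ T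
    · rcases le_total 0 (t - s) with h | h
      · rw [abs_of_nonneg h] at hs ⊢
        refine le_add_right (le_add_right (le_of_eq ?_))
        rw [hf, Set.indicator_of_mem (show t - s ∈ Set.Icc 0 T from ⟨h, hs⟩)]
      · rw [abs_of_nonpos h, neg_sub] at hs ⊢
        refine le_add_right (le_add_left (le_of_eq ?_))
        rw [hf, Set.indicator_of_mem (show s - t ∈ Set.Icc 0 T from ⟨by linarith, hs⟩)]
    · push Not at hs
      exact le_add_left (ENNReal.ofReal_le_ofReal
        (Real.rpow_le_rpow_of_nonpos hT hs.le (by linarith)))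
  have h1 : ∫⁻ s, f (t - s) = ∫⁻ u, f u := lintegral_sub_left_eq_self f t
  have h2 : ∫⁻ s, f (s - t) = ∫⁻ u, f u := lintegral_sub_right_eq_self f t
  calc _ ≤ ∫⁻ s in Set.Icc 0 T, (f (t - s) + f (s - t) + ENNReal.ofReal (T ^ (-1 + e))) :=
        lintegral_mono hpt
    _ = (∫⁻ s in Set.Icc 0 T, f (t - s)) + (∫⁻ s in Set.Icc 0 T, f (s - t))
        + ENNReal.ofReal (T ^ (-1 + e)) * ENNReal.ofReal T := by
        rw [lintegral_add_right _ measurable_const, lintegral_add_left (by fun_prop),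
          setLIntegral_const, Real.volume_Icc, sub_zero]
    _ ≤ (∫⁻ s, f (t - s)) + (∫⁻ s, f (s - t)) + ENNReal.ofReal (T ^ (-1 + e)) * ENNReal.ofReal T :=
        add_le_add_left (add_le_add (setLIntegral_le_lintegral _ _)
          (setLIntegral_le_lintegral _ _)) _
    _ = _ := by
        have hTe : T ^ (-1 + e) * T = T ^ e := by
          conv_lhs => rw [← Real.rpow_one T, ← Real.rpow_mul hT.le, ← Real.rpow_add hT]
          congr 1; ring
        rw [h1, h2, hfint, ← ENNReal.ofReal_mul (by positivity), hTe,
          ← ENNReal.ofReal_add (by positivity) (by positivity),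
          ← ENNReal.ofReal_add (by positivity) (by positivity)]
        congr 1; ring

theorem cutoff_nonneg (a b u : ℝ) : 0 ≤ cutoff a b u :=
  Set.indicator_nonneg (fun _ _ => zero_le_one) _

theorem cutoff_le_one (a b u : ℝ) : cutoff a b u ≤ 1 :=
  Set.indicator_le_self' (fun _ _ => zero_le_one) _

theorem cutoff_mul_rpow_le {κ a b u : ℝ} (hκ : 0 ≤ κ) (ha : 0 < a) :
    cutoff a b u * |u| ^ (-κ) ≤ a ^ (-κ) := by
  by_cases h : |u| ∈ Set.Icc a b
  · rw [cutoff_of_mem h, one_mul]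
    exact Real.rpow_le_rpow_of_nonpos ha h.1 (by linarith)
  · rw [cutoff_of_notMem h, zero_mul]; positivity

theorem measurable_truncWeight (κ δ a b : ℝ) : Measurable (truncWeight κ δ a b) := by
  have h0 : Measurable fun ζ : Plane => ζ 0 := by fun_prop
  have h1 : Measurable fun ζ : Plane => ζ 1 := by fun_prop
  exact (((measurable_cutoff a b).comp h0).mul ((measurable_cutoff a b).comp h1)).mul
    (((measurable_abs.comp h0).pow_const _).mul ((measurable_abs.comp h1).pow_const _))

theorem truncWeight_nonneg (κ δ a b : ℝ) (ζ : Plane) : 0 ≤ truncWeight κ δ a b ζ :=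
  mul_nonneg (mul_nonneg (cutoff_nonneg _ _ _) (cutoff_nonneg _ _ _)) (by positivity)

theorem memLp_truncWeight {κ δ a b : ℝ} (hκ : 0 ≤ κ) (hδ : 0 ≤ δ) (ha : 0 < a) :
    MemLp (fun ζ => (truncWeight κ δ a b ζ : ℂ)) 2 volume := by
  have hm : Measurable fun ζ => (truncWeight κ δ a b ζ : ℂ) :=
    Complex.measurable_ofReal.comp (measurable_truncWeight κ δ a b)
  have hzero : ∀ ζ, ζ ∉ Metric.closedBall (0 : Plane) (2 * b) → truncWeight κ δ a b ζ = 0 := by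
    intro ζ hζ
    by_cases h0 : |ζ 0| ∈ Set.Icc a b
    · by_cases h1 : |ζ 1| ∈ Set.Icc a b
      · refine absurd ?_ hζ
        rw [mem_closedBall_zero_iff, EuclideanSpace.norm_eq, Fin.sum_univ_two]
        have hb : 0 ≤ b := (abs_nonneg _).trans h0.2
        refine Real.sqrt_le_iff.2 ⟨by positivity, ?_⟩
        have e0 := pow_le_pow_left₀ (abs_nonneg _) h0.2 2
        have e1 := pow_le_pow_left₀ (abs_nonneg _) h1.2 2
        simp only [Real.norm_eq_abs]
        nlinarith
      · simp [truncWeight, cutoff_of_notMem h1]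
    · simp [truncWeight, cutoff_of_notMem h0]
  have hind : (fun ζ => (truncWeight κ δ a b ζ : ℂ))
      = (Metric.closedBall (0 : Plane) (2 * b)).indicator
        fun ζ => (truncWeight κ δ a b ζ : ℂ) := by
    funext ζ
    by_cases hζ : ζ ∈ Metric.closedBall (0 : Plane) (2 * b)
    · rw [Set.indicator_of_mem hζ]
    · rw [Set.indicator_of_notMem hζ, hzero ζ hζ, Complex.ofReal_zero]
  rw [hind, memLp_indicator_iff_restrict measurableSet_closedBall]
  have : IsFiniteMeasure ((volume : Measure Plane).restrict (Metric.closedBall 0 (2 * b))) :=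
    ⟨by rw [Measure.restrict_apply_univ]; exact measure_closedBall_lt_top⟩
  refine MemLp.of_bound hm.aestronglyMeasurable (a ^ (-κ) * a ^ (-δ))
    (Filter.Eventually.of_forall fun ζ => ?_)
  rw [Complex.norm_real, Real.norm_of_nonneg (truncWeight_nonneg _ _ _ _ _)]
  calc truncWeight κ δ a b ζ
      = (cutoff a b (ζ 0) * |ζ 0| ^ (-κ)) * (cutoff a b (ζ 1) * |ζ 1| ^ (-δ)) := by
        rw [truncWeight]; ring
    _ ≤ _ := mul_le_mul (cutoff_mul_rpow_le hκ ha) (cutoff_mul_rpow_le hδ ha)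
        (mul_nonneg (cutoff_nonneg _ _ _) (by positivity)) (by positivity)

/-- The Gram kernel squares the weight, so the vectors carry half of the exponents of the dispersive
estimate. -/
theorem truncWeight_half_sq (κ δ a b : ℝ) (ζ : Plane) :
    truncWeight (κ / 2) (δ / 2) a b ζ * truncWeight (κ / 2) (δ / 2) a b ζ
      = truncWeight κ δ a b ζ := by
  have h : ∀ (x u : ℝ), |u| ^ (-(x / 2)) * |u| ^ (-(x / 2)) = |u| ^ (-x) := fun x u => by
    rw [← sq, ← Real.rpow_natCast, ← Real.rpow_mul (abs_nonneg _)]; congr 1; push_cast; ring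
  calc _ = (cutoff a b (ζ 0) * cutoff a b (ζ 0)) * (cutoff a b (ζ 1) * cutoff a b (ζ 1)) *
        ((|ζ 0| ^ (-(κ / 2)) * |ζ 0| ^ (-(κ / 2))) * (|ζ 1| ^ (-(δ / 2)) * |ζ 1| ^ (-(δ / 2)))) := by
        rw [truncWeight]; ring
    _ = _ := by rw [h, h, cutoff_mul_self, cutoff_mul_self, truncWeight]

theorem memLp_conj_planeWave_mul {m : Plane → ℂ} (hm : MemLp m 2 volume) (α t : ℝ) (z : Plane) :
    MemLp (fun ζ => (starRingEnd ℂ) (planeWave α t z ζ) * m ζ) 2 volume := by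
  refine hm.of_le ((Complex.continuous_conj.measurable.comp
    (measurable_planeWave α t z)).aestronglyMeasurable.mul hm.1)
    (Filter.Eventually.of_forall fun ζ => ?_)
  rw [norm_mul, RCLike.norm_conj, norm_planeWave, one_mul]

/-- The weighted plane wave as an element of `L²`. -/
noncomputable def waveVector {m : Plane → ℂ} (hm : MemLp m 2 volume) (α t : ℝ) (z : Plane) : L2Plane :=
  (memLp_conj_planeWave_mul hm α t z).toLp

theorem continuous_waveVector_time {m : Plane → ℂ} (hm : MemLp m 2 volume) (hmm : Measurable m)
    (α : ℝ) (z : Plane) : Continuous fun t => waveVector hm α t z :=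
  continuous_iff_continuousAt.2 fun t => tendsto_toLp_mul hm hmm
    (fun s => Complex.continuous_conj.measurable.comp (measurable_planeWave α s z))
    (Complex.continuous_conj.measurable.comp (measurable_planeWave α t z))
    (fun s ζ => by rw [Function.comp_apply, RCLike.norm_conj, norm_planeWave])
    (fun ζ => by rw [Function.comp_apply, RCLike.norm_conj, norm_planeWave])
    (Filter.Eventually.of_forall fun ζ =>
      (Complex.continuous_conj.comp (continuous_planeWave_time α z ζ)).tendsto t)
    (fun s => memLp_conj_planeWave_mul hm α s z) (memLp_conj_planeWave_mul hm α t z)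

theorem norm_waveVector {m : Plane → ℂ} (hm : MemLp m 2 volume) (α t : ℝ) (z : Plane) :
    ‖waveVector hm α t z‖ = ‖hm.toLp m‖ := by
  rw [waveVector, Lp.norm_toLp, Lp.norm_toLp]
  congr 1
  refine eLpNorm_congr_norm_ae (Filter.Eventually.of_forall fun ζ => ?_)
  rw [norm_mul, RCLike.norm_conj, norm_planeWave, one_mul]

/-- The inner product is conjugate-linear in its first slot, which undoes the conjugate in
`waveVector`: the pairing is a Fourier integral evaluated at `z`. -/
theorem inner_waveVector {m : Plane → ℂ} (hm : MemLp m 2 volume) (α t : ℝ) (z : Plane)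
    (g : L2Plane) : inner ℂ (waveVector hm α t z) g =
      ∫ ζ, planeWave α t z ζ * ((starRingEnd ℂ) (m ζ) * g ζ) := by
  rw [L2.inner_def]
  refine integral_congr_ae ?_
  filter_upwards [(memLp_conj_planeWave_mul hm α t z).coeFn_toLp] with ζ hζ
  rw [waveVector, hζ, RCLike.inner_apply, map_mul, Complex.conj_conj]
  ring

theorem inner_waveVector_waveVector {m : Plane → ℂ} (hm : MemLp m 2 volume) (α t t' : ℝ)
    (z z' : Plane) : inner ℂ (waveVector hm α t z) (waveVector hm α t' z') =
      ∫ ζ, ((starRingEnd ℂ) (m ζ) * m ζ) * planeWave α (t - t') (z - z') ζ := by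
  rw [inner_waveVector]
  refine integral_congr_ae ?_
  filter_upwards [(memLp_conj_planeWave_mul hm α t' z').coeFn_toLp] with ζ hζ
  rw [waveVector, hζ, ← planeWave_mul_conj]
  ring

/-- The maximal square function estimate for the truncated weighted plane waves. -/
theorem exists_lintegral_iSup_enorm_inner_waveVector_le {α δ : ℝ} (hα₀ : 0 < α) (hα₁ : α ≤ 1)
    (hδ : 0 < δ) (hδ₁ : δ < 1 / 2) : ∃ C : ℝ, 0 < C ∧ ∀ (a b T : ℝ), 0 < a → a ≤ b → 0 < T →
      ∀ (hm : MemLp (fun ζ => (truncWeight (((1 - α) / 2 + δ) / 2) (δ / 2) a b ζ : ℂ)) 2 volume)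
        (z : ℕ → Plane) (g : L2Plane),
      ∫⁻ t in Set.Icc 0 T, ⨆ i, ‖inner ℂ (waveVector hm α t (z i)) g‖ₑ ^ 2 ≤
        ENNReal.ofReal (C * T ^ (δ / (1 + α) + δ / 2)) * ‖g‖ₑ ^ 2 := by
  obtain ⟨C, hC, hK⟩ := norm_integral_truncWeight_mul_planeWave_le hα₀ hα₁ hδ hδ₁
  set e := δ / (1 + α) + δ / 2 with he
  have he₀ : 0 < e := by positivity
  have he₁ : e ≤ 1 := by
    have : δ / (1 + α) ≤ δ := div_le_self hδ.le (by linarith)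
    linarith
  refine ⟨2 * (C * (2 / e + 1)), by positivity, fun a b T ha hab hT hm z g => ?_⟩
  have hmm : Measurable fun ζ => (truncWeight (((1 - α) / 2 + δ) / 2) (δ / 2) a b ζ : ℂ) :=
    Complex.measurable_ofReal.comp (measurable_truncWeight _ _ a b)
  have hmain := lintegral_iSup_enorm_inner_sq_le (μ := volume.restrict (Set.Icc 0 T))
    (V := fun i t => waveVector hm α t (z i)) (B := ‖hm.toLp‖)
    (h := fun t s => ENNReal.ofReal (C * |t - s| ^ (-1 + e)))
    (N := ENNReal.ofReal (C * ((2 / e + 1) * T ^ e)))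
    (fun i => (continuous_waveVector_time hm hmm α (z i)).stronglyMeasurable)
    (fun i t => (norm_waveVector hm α t (z i)).le)
    (by
      refine ENNReal.measurable_ofReal.comp (measurable_const.mul (Measurable.pow_const ?_ _))
      exact measurable_abs.comp (measurable_fst.sub measurable_snd))
    (fun s t => by rw [abs_sub_comm])
    (fun t => by
      simp_rw [ENNReal.ofReal_mul hC.le]
      rw [lintegral_const_mul' _ _ ENNReal.ofReal_ne_top]
      exact mul_le_mul_right (lintegral_Icc_abs_sub_rpow_le he₀ he₁ hT t) _)
    (fun t => by
      -- The diagonal is excluded: there the dispersive bound is not available, and the majorant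
      -- takes the default value `0 ^ (-1 + e) = 0`.
      have hne : ∀ᵐ s ∂(volume.restrict (Set.Icc 0 T)), s ≠ t :=
        ae_restrict_of_ae (Measure.ae_ne volume t)
      filter_upwards [hne] with s hs i j
      rw [inner_waveVector_waveVector, ← ofReal_norm]
      refine ENNReal.ofReal_le_ofReal ?_
      refine le_trans (le_of_eq ?_) (hK (t - s) (z i - z j) a b (sub_ne_zero.2 hs.symm) ha hab)
      simp_rw [Complex.conj_ofReal, ← Complex.ofReal_mul, truncWeight_half_sq])
    g
  refine hmain.trans_eq ?_
  have h2 : ∀ x : ℝ, 2 * ENNReal.ofReal x = ENNReal.ofReal (2 * x) := fun x => by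
    rw [ENNReal.ofReal_mul zero_le_two, ENNReal.ofReal_ofNat]
  rw [h2]
  congr 2; ring

/-! ### From vectors back to the flow, and removal of the truncation. -/

/-- By continuity a dense sequence of points controls the sup norm, which reduces the maximal
function to countably many points. -/
theorem eLpNorm_top_fourierInv_sq_le {F : Plane → ℂ} (h1 : Integrable F) (h2 : MemLp F 2) :
    eLpNorm (𝓕⁻ (h2.toLp F) : L2Plane) ∞ volume ^ 2 ≤
      ⨆ i, ‖𝓕⁻ F (TopologicalSpace.denseSeq Plane i)‖ₑ ^ 2 := by
  rw [eLpNorm_congr_ae (coeFn_fourierInv_toLp h1 h2), ENNReal.sq_le_iff_le_rpow,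
    eLpNorm_exponent_top]
  refine eLpNormEssSup_le_of_ae_enorm_bound (Filter.Eventually.of_forall fun z => ?_)
  rw [← ENNReal.sq_le_iff_le_rpow]
  have hc : Continuous fun z => ‖𝓕⁻ F z‖ₑ ^ 2 :=
    (ENNReal.continuous_pow 2).comp (continuous_fourierInv_of_integrable h1).enorm
  refine (TopologicalSpace.denseRange_denseSeq Plane).induction_on
    (p := fun z => ‖𝓕⁻ F z‖ₑ ^ 2 ≤ ⨆ i, ‖𝓕⁻ F (TopologicalSpace.denseSeq Plane i)‖ₑ ^ 2) z
    (isClosed_le hc continuous_const) fun i => ?_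
  exact le_iSup (fun i => ‖𝓕⁻ F (TopologicalSpace.denseSeq Plane i)‖ₑ ^ 2) i

theorem ae_coord_ne_zero (i : Fin 2) : ∀ᵐ ζ : Plane, ζ i ≠ 0 := by
  have h := (EuclideanSpace.volume_preserving_symm_measurableEquiv_toLp (Fin 2))
    |>.quasiMeasurePreserving.ae (p := fun x : Fin 2 → ℝ => x i ≠ 0)
  exact h (Measure.ae_eval_ne (μ := fun _ : Fin 2 => (volume : Measure ℝ)) i (0 : ℝ))

theorem tendsto_cutoff {u : ℝ} (hu : u ≠ 0) :
    Filter.Tendsto (fun n : ℕ => cutoff (1 / ((n : ℝ) + 1)) (n + 1) u) Filter.atTop (nhds 1) := by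
  refine tendsto_const_nhds.congr' ?_
  have h0 : 0 < |u| := abs_pos.2 hu
  filter_upwards [tendsto_one_div_add_atTop_nhds_zero_nat.eventually (ge_mem_nhds h0),
    Filter.eventually_ge_atTop ⌈|u|⌉₊] with n hn hn'
  rw [cutoff_of_mem ⟨hn, ?_⟩]
  have : |u| ≤ n := Nat.ceil_le.1 hn'
  linarith

theorem truncWeight_mul_rpow {κ δ a b : ℝ} (ha : 0 < a) (ζ : Plane) :
    truncWeight κ δ a b ζ * (|ζ 0| ^ κ * |ζ 1| ^ δ) = cutoff a b (ζ 0) * cutoff a b (ζ 1) := by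
  by_cases h0 : |ζ 0| ∈ Set.Icc a b
  · by_cases h1 : |ζ 1| ∈ Set.Icc a b
    · have p0 : 0 < |ζ 0| := ha.trans_le h0.1
      have p1 : 0 < |ζ 1| := ha.trans_le h1.1
      have q0 := Real.rpow_pos_of_pos p0 κ
      have q1 := Real.rpow_pos_of_pos p1 δ
      rw [truncWeight, cutoff_of_mem h0, cutoff_of_mem h1, Real.rpow_neg p0.le,
        Real.rpow_neg p1.le]
      field_simp
    · simp [truncWeight, cutoff_of_notMem h1]
  · simp [truncWeight, cutoff_of_notMem h0]

/-- The weight is controlled by the symbols on the right-hand side. -/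
theorem rpow_mul_rpow_le_add {s δ : ℝ} (hs : 0 ≤ s) (hδ : 0 < δ) (p q : ℝ) :
    |p| ^ ((2 * s + δ) / 2) * |q| ^ (δ / 2) ≤
      |2 * Real.pi * p| ^ (s + δ) + |2 * Real.pi * p| ^ s * |2 * Real.pi * q| ^ δ := by
  have h2 : ∀ u : ℝ, |u| ≤ |2 * Real.pi * u| := fun u => by
    rw [abs_mul, abs_of_pos Real.two_pi_pos]
    exact le_mul_of_one_le_left (abs_nonneg u) (by linarith [Real.pi_gt_three])
  set P := |2 * Real.pi * p| with hP
  set Q := |2 * Real.pi * q| with hQ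
  have hP0 : 0 ≤ P := abs_nonneg _
  have hQ0 : 0 ≤ Q := abs_nonneg _
  have h1 : |p| ^ ((2 * s + δ) / 2) * |q| ^ (δ / 2) ≤ P ^ ((2 * s + δ) / 2) * Q ^ (δ / 2) :=
    mul_le_mul (Real.rpow_le_rpow (abs_nonneg _) (h2 p) (by linarith))
      (Real.rpow_le_rpow (abs_nonneg _) (h2 q) (by linarith)) (by positivity) (by positivity)
  have e1 : P ^ ((2 * s + δ) / 2) = P ^ s * P ^ (δ / 2) := by
    rw [← Real.rpow_add_of_nonneg hP0 hs (by linarith)]; congr 1; ring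
  have e2 : P ^ (s + δ) = P ^ s * (P ^ (δ / 2) * P ^ (δ / 2)) := by
    rw [← Real.rpow_add_of_nonneg hP0 (by linarith) (by linarith),
      ← Real.rpow_add_of_nonneg hP0 hs (by linarith)]
    congr 1; ring
  have e3 : Q ^ δ = Q ^ (δ / 2) * Q ^ (δ / 2) := by
    rw [← Real.rpow_add_of_nonneg hQ0 (by linarith) (by linarith)]; congr 1; ring
  refine h1.trans ?_
  rw [e1, e2, e3, ← mul_add, mul_assoc]
  refine mul_le_mul_of_nonneg_left ?_ (Real.rpow_nonneg hP0 s)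
  -- With the common factor `P ^ s` removed, this is `p q ≤ p² + q²` for `p = P^(δ/2)`, `q =
  -- Q^(δ/2)`.
  nlinarith [sq_nonneg (P ^ (δ / 2) - Q ^ (δ / 2)), Real.rpow_nonneg hP0 (δ / 2),
    Real.rpow_nonneg hQ0 (δ / 2)]

theorem norm_fourierMultiplier {m : ℝ → ℝ → ℂ} {φ : L2Plane} (h : InMultiplierDomain m φ) :
    ENNReal.ofReal ‖fourierMultiplier m φ h‖
      = eLpNorm (fun ζ => angularSymbol m ζ * (𝓕 φ : L2Plane) ζ) 2 volume := by
  have h' : MemLp (fun ζ : Plane => angularSymbol m ζ * (𝓕 φ : L2Plane) ζ) 2 volume := h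
  have h1 : ‖fourierMultiplier m φ h‖ = ‖h'.toLp‖ :=
    (Lp.fourierTransformₗᵢ Plane ℂ).symm.norm_map _
  rw [h1, Lp.norm_toLp, ENNReal.ofReal_toReal h'.2.ne]

theorem fourier_fourierMultiplier {m : ℝ → ℝ → ℂ} {φ : L2Plane} (h : InMultiplierDomain m φ) :
    ((𝓕 (fourierMultiplier m φ h) : L2Plane) : Plane → ℂ)
      =ᵐ[volume] fun ζ => angularSymbol m ζ * (𝓕 φ : L2Plane) ζ := by
  have h1 : (𝓕 (fourierMultiplier m φ h) : L2Plane) = h.toLp :=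
    (Lp.fourierTransformₗᵢ Plane ℂ).apply_symm_apply _
  rw [h1]
  exact h.coeFn_toLp

theorem measurable_rpow_mul_rpow (κ δ : ℝ) :
    Measurable fun ζ : Plane => ((|ζ 0| ^ κ * |ζ 1| ^ δ : ℝ) : ℂ) := by
  have h0 : Measurable fun ζ : Plane => ζ 0 := by fun_prop
  have h1 : Measurable fun ζ : Plane => ζ 1 := by fun_prop
  exact Complex.measurable_ofReal.comp
    (((measurable_abs.comp h0).pow_const _).mul ((measurable_abs.comp h1).pow_const _))

/-- The weighted Fourier transform is square integrable, with the norm controlled by the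
right-hand side. -/
theorem memLp_weight_mul_fourier {s δ : ℝ} (hs : 0 ≤ s) (hδ : 0 < δ) {φ : L2Plane}
    (hx : InDomainDx (s + δ) φ) (hy : InDomainDy δ φ) (hxy : InDomainDx s (Dy δ φ hy)) :
    MemLp (fun ζ : Plane => ((|ζ 0| ^ ((2 * s + δ) / 2) * |ζ 1| ^ (δ / 2) : ℝ) : ℂ) *
        (𝓕 φ : L2Plane) ζ) 2 volume ∧
      eLpNorm (fun ζ : Plane => ((|ζ 0| ^ ((2 * s + δ) / 2) * |ζ 1| ^ (δ / 2) : ℝ) : ℂ) *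
        (𝓕 φ : L2Plane) ζ) 2 volume
          ≤ ENNReal.ofReal (‖Dx (s + δ) φ hx‖ + ‖Dx s (Dy δ φ hy) hxy‖) := by
  set G : Plane → ℂ := fun ζ => ((|ζ 0| ^ ((2 * s + δ) / 2) * |ζ 1| ^ (δ / 2) : ℝ) : ℂ) *
        (𝓕 φ : L2Plane) ζ with hG
  have hGm : AEStronglyMeasurable G volume :=
    (measurable_rpow_mul_rpow _ _).aestronglyMeasurable.mul (Lp.aestronglyMeasurable _)
  set H₁ : Plane → ℂ := fun ζ => angularSymbol (symbolDx (s + δ)) ζ * (𝓕 φ : L2Plane) ζ with hH₁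
  set H₂ : Plane → ℂ := fun ζ => angularSymbol (symbolDx s) ζ * (𝓕 (Dy δ φ hy) : L2Plane) ζ with hH₂
  have hle : eLpNorm G 2 volume ≤ eLpNorm (fun ζ => ‖H₁ ζ‖ + ‖H₂ ζ‖) 2 volume := by
    refine eLpNorm_mono_ae_real ?_
    filter_upwards [fourier_fourierMultiplier hy] with ζ hζ
    have hn : ∀ x : ℝ, 0 ≤ x → ‖(x : ℂ)‖ = x := fun x hx => by
      rw [Complex.norm_real, Real.norm_of_nonneg hx]
    have e2 : ‖H₂ ζ‖ = |2 * Real.pi * ζ 0| ^ s * |2 * Real.pi * ζ 1| ^ δ *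
        ‖(𝓕 φ : L2Plane) ζ‖ := by
      simp only [hH₂, Dy]
      rw [hζ, norm_mul, norm_mul]
      simp only [angularSymbol, symbolDx, symbolDy]
      rw [hn _ (by positivity), hn _ (by positivity)]
      exact (mul_assoc _ _ _).symm
    rw [e2]
    simp only [hG, hH₁, norm_mul, angularSymbol, symbolDx]
    rw [hn _ (by positivity), hn _ (by positivity), ← add_mul]
    exact mul_le_mul_of_nonneg_right (rpow_mul_rpow_le_add hs hδ _ _) (norm_nonneg _)
  have hbound : eLpNorm G 2 volume ≤
      ENNReal.ofReal (‖Dx (s + δ) φ hx‖ + ‖Dx s (Dy δ φ hy) hxy‖) := by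
    refine hle.trans ((eLpNorm_add_le hx.1.norm hxy.1.norm one_le_two).trans_eq ?_)
    have n1 : ENNReal.ofReal ‖Dx (s + δ) φ hx‖ = eLpNorm H₁ 2 volume := norm_fourierMultiplier hx
    have n2 : ENNReal.ofReal ‖Dx s (Dy δ φ hy) hxy‖ = eLpNorm H₂ 2 volume :=
      norm_fourierMultiplier hxy
    rw [ENNReal.ofReal_add (norm_nonneg _) (norm_nonneg _), n1, n2, eLpNorm_norm, eLpNorm_norm]
  exact ⟨⟨hGm, hbound.trans_lt ENNReal.ofReal_lt_top⟩, hbound⟩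

theorem measurable_symbolU_mul_cutoff (α t a b : ℝ) : Measurable fun ζ : Plane =>
    angularSymbol (symbolU α t) ζ * ((cutoff a b (ζ 0) * cutoff a b (ζ 1) : ℝ) : ℂ) := by
  have h0 : Measurable fun ζ : Plane => ζ 0 := by fun_prop
  have h1 : Measurable fun ζ : Plane => ζ 1 := by fun_prop
  exact (measurable_angularSymbol_symbolU α t).mul (Complex.measurable_ofReal.comp
    (((measurable_cutoff a b).comp h0).mul ((measurable_cutoff a b).comp h1)))

theorem norm_symbolU_mul_cutoff_le (α t a b : ℝ) (ζ : Plane) :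
    ‖angularSymbol (symbolU α t) ζ * ((cutoff a b (ζ 0) * cutoff a b (ζ 1) : ℝ) : ℂ)‖ ≤ 1 := by
  rw [norm_mul, angularSymbol, norm_symbolU, one_mul, Complex.norm_real, Real.norm_of_nonneg
    (mul_nonneg (cutoff_nonneg _ _ _) (cutoff_nonneg _ _ _))]
  exact mul_le_one₀ (cutoff_le_one _ _ _) (cutoff_nonneg _ _ _) (cutoff_le_one _ _ _)

theorem memLp_symbolU_mul_cutoff_mul (α t a b : ℝ) (φ : L2Plane) :
    MemLp (fun ζ => (angularSymbol (symbolU α t) ζ *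
      ((cutoff a b (ζ 0) * cutoff a b (ζ 1) : ℝ) : ℂ)) * (𝓕 φ : L2Plane) ζ) 2 volume := by
  refine (Lp.memLp (𝓕 φ : L2Plane)).of_le ((measurable_symbolU_mul_cutoff α t a
    b).aestronglyMeasurable.mul (Lp.aestronglyMeasurable _)) (Filter.Eventually.of_forall
      fun ζ => ?_)
  rw [norm_mul]
  exact mul_le_of_le_one_left (norm_nonneg _) (norm_symbolU_mul_cutoff_le α t a b ζ)

/-- The cutoffs tend to `1` off the coordinate axes, a null set; dominated convergence and
Plancherel do the rest. -/
theorem tendsto_fourierInv_cutoff (α t : ℝ) (φ : L2Plane) :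
    Filter.Tendsto (fun n : ℕ => (𝓕⁻ ((memLp_symbolU_mul_cutoff_mul α t (1 / ((n : ℝ) + 1)) (n + 1)
      φ).toLp) : L2Plane)) Filter.atTop (nhds (U α t φ)) := by
  refine ((Lp.fourierTransformₗᵢ Plane ℂ).symm.continuous.tendsto _).comp
    (tendsto_toLp_mul (Lp.memLp (𝓕 φ : L2Plane)) (Lp.stronglyMeasurable _).measurable
      (fun n => measurable_symbolU_mul_cutoff α t _ _) (measurable_angularSymbol_symbolU α t)
      (fun n ζ => norm_symbolU_mul_cutoff_le α t _ _ ζ)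
      (fun ζ => by rw [angularSymbol, norm_symbolU]) ?_
      (fun n => memLp_symbolU_mul_cutoff_mul α t _ _ φ) (inMultiplierDomain_symbolU α t φ))
  filter_upwards [ae_coord_ne_zero 0, ae_coord_ne_zero 1] with ζ h0 h1
  have h := (((tendsto_cutoff h0).mul (tendsto_cutoff h1)).ofReal).const_mul
    (angularSymbol (symbolU α t) ζ)
  simpa using h

/-- The pointwise in time bound for the truncated evolution. -/
theorem eLpNorm_top_fourierInv_cutoff_sq_le {α t a b κ δ : ℝ} (ha : 0 < a) (φ : L2Plane)
    (hm : MemLp (fun ζ => (truncWeight κ δ a b ζ : ℂ)) 2 volume)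
    (hg : MemLp (fun ζ : Plane => ((|ζ 0| ^ κ * |ζ 1| ^ δ : ℝ) : ℂ) * (𝓕 φ : L2Plane) ζ) 2
      volume) :
    eLpNorm (𝓕⁻ ((memLp_symbolU_mul_cutoff_mul α t a b φ).toLp) : L2Plane) ∞ volume ^ 2 ≤
      ⨆ i, ‖inner ℂ (waveVector hm α t (TopologicalSpace.denseSeq Plane i)) hg.toLp‖ₑ ^ 2 := by
  have hprod : ∀ ζ : Plane, (truncWeight κ δ a b ζ : ℂ) *
      (((|ζ 0| ^ κ * |ζ 1| ^ δ : ℝ) : ℂ) * (𝓕 φ : L2Plane) ζ) =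
      ((cutoff a b (ζ 0) * cutoff a b (ζ 1) : ℝ) : ℂ) * (𝓕 φ : L2Plane) ζ := fun ζ => by
    rw [← mul_assoc, ← Complex.ofReal_mul, truncWeight_mul_rpow ha]
  -- The truncated transform is a product of two `L²` functions: the truncated weight and the
  -- transform multiplied by the inverse weight.
  have h1 : Integrable (fun ζ => (angularSymbol (symbolU α t) ζ *
      ((cutoff a b (ζ 0) * cutoff a b (ζ 1) : ℝ) : ℂ)) * (𝓕 φ : L2Plane) ζ) := by
    have hi := hm.integrable_mul hg
    refine hi.mono (memLp_symbolU_mul_cutoff_mul α t a b φ).1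
      (Filter.Eventually.of_forall fun ζ => ?_)
    rw [Pi.mul_apply, hprod, mul_assoc, norm_mul, angularSymbol, norm_symbolU, one_mul]
  refine (eLpNorm_top_fourierInv_sq_le h1 _).trans_eq (iSup_congr fun i => ?_)
  congr 2
  rw [inner_waveVector, Real.fourierInv_eq']
  refine integral_congr_ae ?_
  filter_upwards [hg.coeFn_toLp] with ζ hζ
  rw [hζ, Complex.conj_ofReal, hprod, planeWave, smul_eq_mul]
  ring

theorem corollary3p3 (α : ℝ) (hα₀ : 0 < α) (hα₁ : α ≤ 1) :
    ∃ δ₀ : ℝ, 0 < δ₀ ∧ ∀ δ : ℝ, 0 < δ → δ < δ₀ →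
      ∃ k : ℝ, 0 < k ∧ k < 1 / 2 ∧ ∃ c : ℝ, 0 < c ∧
        ∀ (T : ℝ), 0 < T → ∀ (φ : L2Plane)
          (hx : InDomainDx ((1 / 4) * (1 - α) + δ) φ)
          (hy : InDomainDy δ φ)
          (hxy : InDomainDx ((1 / 4) * (1 - α)) (Dy δ φ hy)),
          mixedNorm 2 ∞ T (fun t => U α t φ) ≤
            ENNReal.ofReal (c * T ^ k *
              (‖φ‖ + ‖Dx ((1 / 4) * (1 - α) + δ) φ hx‖ + ‖Dy δ φ hy‖
                + ‖Dx ((1 / 4) * (1 - α)) (Dy δ φ hy) hxy‖)) := by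
  refine ⟨1 / 2, by norm_num, fun δ hδ hδ₁ => ?_⟩
  have hd : δ / (1 + α) ≤ δ := div_le_self hδ.le (by linarith)
  -- Half of the exponent `e` of the squared norm; `δ < 1/2` gives `e < 3/4`.
  refine ⟨(δ / (1 + α) + δ / 2) / 2, by positivity, by linarith, ?_⟩
  obtain ⟨C, hC, hmain⟩ := exists_lintegral_iSup_enorm_inner_waveVector_le hα₀ hα₁ hδ hδ₁
  set e := δ / (1 + α) + δ / 2 with he
  refine ⟨√C, Real.sqrt_pos.2 hC, fun T hT φ hx hy hxy => ?_⟩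
  obtain ⟨hg, hgn⟩ := memLp_weight_mul_fourier (by linarith : 0 ≤ 1 / 4 * (1 - α)) hδ hx hy hxy
  rw [show 2 * (1 / 4 * (1 - α)) + δ = (1 - α) / 2 + δ by ring] at hg hgn
  set W := ‖Dx (1 / 4 * (1 - α) + δ) φ hx‖ + ‖Dx (1 / 4 * (1 - α)) (Dy δ φ hy) hxy‖ with hW
  have hm : ∀ n : ℕ, MemLp (fun ζ => (truncWeight (((1 - α) / 2 + δ) / 2) (δ / 2)
      (1 / ((n : ℝ) + 1)) (n + 1) ζ : ℂ)) 2 volume := fun n =>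
    memLp_truncWeight (by linarith) (by linarith) (by positivity)
  have hmm : ∀ n : ℕ, Measurable fun ζ => (truncWeight (((1 - α) / 2 + δ) / 2) (δ / 2)
      (1 / ((n : ℝ) + 1)) (n + 1) ζ : ℂ) := fun n =>
    Complex.measurable_ofReal.comp (measurable_truncWeight _ _ _ _)
  have hsq : ∀ t, eLpNorm (U α t φ) ∞ volume ^ 2 ≤ Filter.atTop.liminf fun n =>
      ⨆ i, ‖inner ℂ (waveVector (hm n) α t (TopologicalSpace.denseSeq Plane i)) hg.toLp‖ₑ ^ 2 :=
    fun t => eLpNorm_top_sq_le_liminf_of_tendsto (tendsto_fourierInv_cutoff α t φ)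
      fun n => eLpNorm_top_fourierInv_cutoff_sq_le (by positivity) φ (hm n) hg
  have hgW : ‖hg.toLp‖ₑ ≤ ENNReal.ofReal W := by
    rw [Lp.enorm_toLp]; exact hgn
  have hint : ∫⁻ t in Set.Icc 0 T, eLpNorm (U α t φ) ∞ volume ^ 2 ≤
      ENNReal.ofReal (C * T ^ e * W ^ 2) := by
    -- Fatou's lemma; the bound for the truncated problems does not depend on `n`.
    refine (lintegral_mono hsq).trans ((lintegral_liminf_le fun n => Measurable.iSup fun i =>
      ((continuous_waveVector_time (hm n) (hmm n) α _).inner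
        continuous_const).enorm.measurable.pow_const 2).trans ?_)
    refine Filter.liminf_le_of_le (by isBoundedDefault) fun c hc => ?_
    obtain ⟨n, hn⟩ := hc.exists
    refine hn.trans ((hmain _ _ T (by positivity) ?_ hT (hm n) _ _).trans ?_)
    · have h0 : (0 : ℝ) ≤ n := n.cast_nonneg
      rw [div_le_iff₀ (by positivity)]
      nlinarith
    · rw [ENNReal.ofReal_mul (p := C * T ^ e) (by positivity),
        ENNReal.ofReal_pow (by positivity)]
      exact mul_le_mul_right (pow_le_pow_left' hgW 2) _
  have hroot : mixedNorm 2 ∞ T (fun t => U α t φ) ^ 2 ≤ ENNReal.ofReal (C * T ^ e * W ^ 2) := by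
    refine le_trans (le_of_eq ?_) hint
    rw [mixedNorm, eLpNorm_eq_lintegral_rpow_enorm_toReal two_ne_zero ENNReal.ofNat_ne_top,
      ENNReal.toReal_ofNat, ← ENNReal.rpow_two, ← ENNReal.rpow_mul]
    norm_num
  have hfin : C * T ^ e * W ^ 2 ≤ (√C * T ^ (e / 2) *
      (‖φ‖ + ‖Dx ((1 / 4) * (1 - α) + δ) φ hx‖ + ‖Dy δ φ hy‖
        + ‖Dx ((1 / 4) * (1 - α)) (Dy δ φ hy) hxy‖)) ^ 2 := by
    have e1 : (T ^ (e / 2)) ^ 2 = T ^ e := by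
      rw [← Real.rpow_natCast, ← Real.rpow_mul hT.le]; congr 1; push_cast; ring
    rw [mul_pow, mul_pow, Real.sq_sqrt hC.le, e1]
    have hWle : W ≤ ‖φ‖ + ‖Dx ((1 / 4) * (1 - α) + δ) φ hx‖ + ‖Dy δ φ hy‖
        + ‖Dx ((1 / 4) * (1 - α)) (Dy δ φ hy) hxy‖ := by
      rw [hW]; linarith [norm_nonneg φ, norm_nonneg (Dy δ φ hy)]
    gcongr
  refine (ENNReal.pow_le_pow_left_iff two_ne_zero).1 (hroot.trans ?_)
  rw [← ENNReal.ofReal_pow (by positivity)]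
  exact ENNReal.ofReal_le_ofReal hfin
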